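/- Let $G$ be a connected and simply connected (finite-dimensional, real) Lie group with Lie algebra $\mathfrak g$. Let $G$ act on $\mathfrak g^*$ by the coadjoint action $\langle K(g)F,X\rangle=\langle F,\mathrm{Ad}(g^{-1})X\rangle$. For $F\in\mathfrak g^*$ let $\mathcal O=K(G)F\cong G/G_F$ be its coadjoint orbit, where $G_F$ is the stabilizer of $F$, with Lie algebra $\mathfrak g_F=\{X:\langle F,[X,Y]\rangle=0\ \ \forall\, Y\in\mathfrak g\}$. The orbit carries the smooth structure of the homogeneous space $G/G_F$ and the Kirillov form $\omega_x(\xi_X,\xi_Y)=\langle x,[X,Y]\rangle$, where $\xi_X$ is the vector field on $\mathcal O$ generated by $X\in\mathfrak g$. Put $\tilde X(x)=\langle x,X\rangle$ for $x\in\mathcal O$. Suppose that there is a polarization $\mathfrak p$ at $F$, that is, a complex Lie subalgebra $\mathfrak p\subseteq\mathfrak g_{\mathbf C}$ such that $\mathfrak g_F\subseteq\mathfrak p$; $\mathfrak p$ is invariant under $\mathrm{Ad}(g)$ for all $g\in G_F$; $\mathfrak p+\overline{\mathfrak p}$ is the complexification of a real Lie subalgebra of $\mathfrak g$; and the real subalgebra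 $\mathfrak h:=\mathfrak p\cap\mathfrak g$ is Lagrangian, i.e. $\langle F,[\mathfrak h,\mathfrak h]\rangle=0$ and $\operatorname{codim}_{\mathfrak g}\mathfrak h=\tfrac12\dim\mathcal O$. Suppose also that it satisfies the Pukanszky condition $F+\mathfrak h^\perp\subseteq\mathcal O$, where $\mathfrak h^\perp\subseteq\mathfrak g^*$ is the annihilator of $\mathfrak h$. Then, with $n=\tfrac12\dim\mathcal O$, every point of $\mathcal O$ has an open neighbourhood $V\subseteq\mathcal O$ with smooth local coordinates $(q,p)=(q^1,\dots,q^n,p_1,\dots,p_n)$ on $V$ such that $\omega=\sum_{i=1}^n dp_i\wedge dq^i$ on $V$ and, for every $X\in\mathfrak g$, there are smooth functions $a_0,a_1,\dots,a_n$ on the open set $q(V)\subseteq\mathbf R^n$ with $$\tilde X=\sum_{i=1}^n a_i(q)\,p_i+a_0(q)\qquad\text{on }V.$$ -/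

import Mathlib

open scoped Manifold ContDiff TensorProduct

noncomputable section

namespace CoadjointOrbit

/-- A smooth Lie group has the smoothness that Mathlib asks for to define its Lie algebra. -/
instance instLEInftyMinSmoothness : ENat.LEInfty (minSmoothness ℝ 3) :=
  ⟨by rw [minSmoothness_of_isRCLikeNormedField]; exact ENat.LEInfty.out⟩

instance instCompleteOfFiniteDimensional (E : Type*) [NormedAddCommGroup E] [NormedSpace ℝ E]
    [FiniteDimensional ℝ E] : CompleteSpace E :=
  FiniteDimensional.complete ℝ E

variable {E : Type*} [NormedAddCommGroup E] [NormedSpace ℝ E]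
  {G : Type*} [TopologicalSpace G] [ChartedSpace E G] [Group G]

/-- The Lie algebra `𝔤 = T₁G` of the Lie group `G` (modelled on the real vector space `E`), with
Mathlib's bracket, the one of left-invariant vector fields. -/
abbrev LieAlg (E G : Type*) [NormedAddCommGroup E] [NormedSpace ℝ E]
    [TopologicalSpace G] [ChartedSpace E G] [Group G] : Type _ :=
  GroupLieAlgebra 𝓘(ℝ, E) G

/-- The dual space `𝔤*`. -/
abbrev DualLieAlg (E G : Type*) [NormedAddCommGroup E] [NormedSpace ℝ E]
    [TopologicalSpace G] [ChartedSpace E G] [Group G] : Type _ :=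
  Module.Dual ℝ (LieAlg E G)

/-- The adjoint action: `Ad g` is the differential at the identity of `x ↦ g x g⁻¹`. -/
def Ad (g : G) : LieAlg E G →ₗ[ℝ] LieAlg E G :=
  ContinuousLinearMap.toLinearMap
    (mfderiv 𝓘(ℝ, E) 𝓘(ℝ, E) (fun x : G => g * x * g⁻¹) 1 : LieAlg E G →L[ℝ] LieAlg E G)

/-- The coadjoint action `K(g) = Ad(g⁻¹)*`, that is `⟨K(g) F, X⟩ = ⟨F, Ad(g⁻¹) X⟩`. -/
def coAd (g : G) (F : DualLieAlg E G) : DualLieAlg E G :=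
  F ∘ₗ Ad g⁻¹

/-- The coadjoint orbit of `F`. -/
def orbit (F : DualLieAlg E G) : Set (DualLieAlg E G) :=
  Set.range fun g : G => coAd g F

/-- The stabilizer `G_F` of `F`, as a set. -/
def stabilizer (F : DualLieAlg E G) : Set G :=
  {g | coAd g F = F}

/-- The function `X̃(x) = ⟨x, X⟩` on `𝔤*`; on an orbit it is the Hamiltonian function of `X`. -/
def hamiltonian (X : LieAlg E G) (x : DualLieAlg E G) : ℝ :=
  x X

/-- The derivative at `x` of a function `f` on the coadjoint orbit of `x` along the fundamental
vector field `ξ_X` of the coadjoint action: the derivative of `h ↦ f (K(h) x)` at `h = 1` in the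
direction `X`. The vectors `ξ_X` at `x` make up the whole tangent space of the orbit at `x`. -/
def fundDeriv (f : DualLieAlg E G → ℝ) (x : DualLieAlg E G) (X : LieAlg E G) : ℝ :=
  (mfderiv 𝓘(ℝ, E) 𝓘(ℝ, ℝ) (fun h : G => f (coAd h x)) 1 : LieAlg E G →L[ℝ] ℝ) X

/-- Local coordinates `c` on the part `V` of the orbit `𝒪` of `F`, where `𝒪 ≅ G / G_F` has the
topology and the smooth structure of the homogeneous space: a subset of `𝒪` is open iff its
preimage under `g ↦ K(g) F` is open in `G`, and a map on an open subset of `𝒪` is smooth iff its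
pullback to `G` is, a submersion iff its pullback is. An injective smooth submersion `c : V → B`
is a diffeomorphism of `V` onto an open subset of `B`, i.e. a chart. -/
structure IsLocalCoordinates [FiniteDimensional ℝ E] {B : Type*} [NormedAddCommGroup B]
    [NormedSpace ℝ B] (F : DualLieAlg E G) (V : Set (DualLieAlg E G))
    (c : DualLieAlg E G → B) : Prop where
  subset_orbit : V ⊆ orbit F
  isOpen_preimage : IsOpen {g : G | coAd g F ∈ V}
  injOn : Set.InjOn c V
  smooth : ContMDiffOn 𝓘(ℝ, E) 𝓘(ℝ, B) ∞ (fun g : G => c (coAd g F)) {g : G | coAd g F ∈ V}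
  submersion : ∀ g : G, coAd g F ∈ V →
    Function.Surjective (mfderiv 𝓘(ℝ, E) 𝓘(ℝ, B) (fun g : G => c (coAd g F)) g)

section

variable [FiniteDimensional ℝ E] [LieGroup 𝓘(ℝ, E) ∞ G]

/-- The Kirillov form of the orbit through `x`: `ω_x(ξ_X, ξ_Y) = ⟨x, [X, Y]⟩`. -/
def kirillovForm (x : DualLieAlg E G) (X Y : LieAlg E G) : ℝ :=
  x ⁅X, Y⁆

/-- The Lie algebra `𝔤_F` of the stabilizer of `F`: the elements `X` annihilating `F` in the
coadjoint representation of `𝔤`, i.e. with `⟨F, [X, Y]⟩ = 0` for all `Y`. -/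
def stabAlg (F : DualLieAlg E G) : Submodule ℝ (LieAlg E G) where
  carrier := {X | ∀ Y, F ⁅X, Y⁆ = 0}
  add_mem' := by
    intro a b ha hb Y
    rw [add_lie, map_add, ha Y, hb Y, add_zero]
  zero_mem' := by
    intro Y
    rw [zero_lie, map_zero]
  smul_mem' := by
    intro c a ha Y
    rw [smul_lie, map_smul, ha Y, smul_zero]

/-- The dimension of the coadjoint orbit of `F`, `dim 𝔤 - dim 𝔤_F` (the rank at `F` of the
Kirillov form). -/
def orbitDim (F : DualLieAlg E G) : ℕ :=
  Module.finrank ℝ (LieAlg E G) - Module.finrank ℝ (stabAlg F)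

/-- The complexification `𝔤_ℂ`. -/
abbrev ComplexLieAlg (E G : Type*) [NormedAddCommGroup E] [NormedSpace ℝ E]
    [TopologicalSpace G] [ChartedSpace E G] [Group G] : Type _ :=
  ℂ ⊗[ℝ] LieAlg E G

/-- Complex conjugation `z ⊗ X ↦ z̄ ⊗ X` of `𝔤_ℂ`, as a real linear map. -/
def conj : ComplexLieAlg E G →ₗ[ℝ] ComplexLieAlg E G :=
  LinearMap.rTensor (LieAlg E G) Complex.conjAe.toLinearMap

/-- The real part `𝔥 = 𝔭 ∩ 𝔤` of a complex subalgebra `𝔭` of `𝔤_ℂ`. -/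
def realSubalg (𝔭 : LieSubalgebra ℂ (ComplexLieAlg E G)) : Submodule ℝ (LieAlg E G) :=
  (𝔭.toSubmodule.restrictScalars ℝ).comap (TensorProduct.mk ℝ ℂ (LieAlg E G) 1)

/-- `𝔭` is a polarization at `F`. -/
structure IsPolarization (F : DualLieAlg E G) (𝔭 : LieSubalgebra ℂ (ComplexLieAlg E G)) :
    Prop where
  /-- `𝔤_F ⊆ 𝔭` -/
  stab_le : stabAlg F ≤ realSubalg 𝔭
  /-- `𝔭` is invariant under `Ad(g)`, `g ∈ G_F` -/
  ad_invariant : ∀ g ∈ stabilizer F, ∀ Z ∈ 𝔭, (Ad g).baseChange ℂ Z ∈ 𝔭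
  /-- `𝔭 + 𝔭̄` is the complexification of a real Lie subalgebra of `𝔤` -/
  add_conj : ∃ 𝔪 : LieSubalgebra ℝ (LieAlg E G),
    𝔭.toSubmodule.restrictScalars ℝ ⊔ (𝔭.toSubmodule.restrictScalars ℝ).map conj =
      (𝔪.toSubmodule.baseChange ℂ).restrictScalars ℝ
  /-- `𝔥 = 𝔭 ∩ 𝔤` is isotropic for the Kirillov form at `F` -/
  isotropic : ∀ X ∈ realSubalg 𝔭, ∀ Y ∈ realSubalg 𝔭, kirillovForm F X Y = 0
  /-- `codim 𝔥 = ½ dim 𝒪`; together with the preceding field, `𝔥` is Lagrangian -/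
  codim : 2 * Module.finrank ℝ (LieAlg E G ⧸ realSubalg 𝔭) = orbitDim F

/-- The Pukanszky condition `F + 𝔥^⊥ ⊆ 𝒪`, where `𝔥 = 𝔭 ∩ 𝔤` and `𝔥^⊥ ⊆ 𝔤*` is the annihilator
of `𝔥`. -/
def PukanszkyCondition (F : DualLieAlg E G) (𝔭 : LieSubalgebra ℂ (ComplexLieAlg E G)) : Prop :=
  ∀ ν ∈ (realSubalg 𝔭).dualAnnihilator, F + ν ∈ orbit F

/-- `(q, p)` are local Darboux coordinates on the part `V` of the orbit of `F`: local coordinates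
in which the Kirillov form is `∑ i, dp_i ∧ dq^i`. -/
structure IsDarbouxCoordinates (n : ℕ) (F : DualLieAlg E G)
    (V : Set (DualLieAlg E G)) (q p : DualLieAlg E G → Fin n → ℝ) : Prop where
  isLocalCoordinates : IsLocalCoordinates F V (fun x => (q x, p x))
  darboux : ∀ x ∈ V, ∀ X Y : LieAlg E G,
    kirillovForm x X Y = ∑ i : Fin n,
      (fundDeriv (fun y => p y i) x X * fundDeriv (fun y => q y i) x Y -
        fundDeriv (fun y => q y i) x X * fundDeriv (fun y => p y i) x Y)

end

end CoadjointOrbit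

end

/-! Choose a complement of `𝔥` spanned by `e i`, and `f j ∈ 𝔥` dual to the `e i` for the Kirillov
form at `F`. Near `F` the orbit is foliated by translates of pieces of the affine space `F + 𝔥^⊥`.
The leaf through `x` is indexed by a point `s = ∑ qᵢ eᵢ` of a transversal in the group chart, chosen
so that the point `y = x ∘ Ad(s)`, which is `x` moved back by the coadjoint action, agrees with `F`
on `𝔥`.

Imposing agreement on the `f j` alone gives `n` equations for `q`. The implicit function theorem
solves them on an open set of the whole dual space (`exists_leafParameter`). The crux is that on the
orbit agreement then holds on all of `𝔥`. Along a ray from the identity, the defect `δ = (y - F)|𝔥`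
satisfies `‖δ'‖ ≤ C ‖δ‖`, because the radical of the form at `y` is a transported copy of the
radical at `F` (`exists_bound`), so `δ` vanishes by Grönwall (`leafPoint_eq_of_ray`).

The conjugate momenta are `pᵢ = -y(ε(s) eᵢ)`, with `ε` the left Maurer-Cartan form. Moved back to
`y`, a direction `X` splits into `ε(s)(∑ dqᵢ(ξ_X) eᵢ)` and a part in `𝔥`. Isotropy removes the
bracket of two parts in `𝔥`, and the Maurer-Cartan equation matches the remaining terms with `∑ dpᵢ
∧ dqⁱ` (`darboux`). Likewise `x(X) = y(Ad(s)⁻¹ X)` is computed by splitting `Ad(s)⁻¹ X` along `ε(s)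
eᵢ` and `𝔥`. The first part gives a combination of the `pᵢ`, the second the value of `F`, and all
coefficients depend on `q` only (`exists_affine`).

Nondegeneracy of the coordinates follows from the Darboux identity and a dimension count.
Injectivity holds because `q` and `p` determine every `X̃`. This local model is realised in the
chart of `G` at the identity (`adjointChart`). An arbitrary point `K(g₀)F` is treated by replacing
`𝔥` with `Ad(g₀)𝔥`. -/

noncomputable section

namespace CoadjointOrbit

section

/-! ### Smooth implicit function theorem. -/

section Implicit

variable {X Q : Type*} [NormedAddCommGroup X] [NormedSpace ℝ X] [CompleteSpace X]
  [NormedAddCommGroup Q] [NormedSpace ℝ Q] [CompleteSpace Q]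

/-- The shear `(x, q) ↦ (x, D (x, 0) + q)`. -/
def shearEquiv (D : X × Q →L[ℝ] Q) : (X × Q) ≃L[ℝ] (X × Q) :=
  ContinuousLinearEquiv.equivOfInverse
    ((ContinuousLinearMap.fst ℝ X Q).prod
      (D ∘L (ContinuousLinearMap.inl ℝ X Q) ∘L ContinuousLinearMap.fst ℝ X Q
        + ContinuousLinearMap.snd ℝ X Q))
    ((ContinuousLinearMap.fst ℝ X Q).prod
      (ContinuousLinearMap.snd ℝ X Q
        - D ∘L (ContinuousLinearMap.inl ℝ X Q) ∘L ContinuousLinearMap.fst ℝ X Q))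
    (fun z => by ext <;> simp) (fun z => by ext <;> simp)

/-- Implicit function theorem with smoothness on a whole neighbourhood, for an equation normalised
to have partial derivative `1` in the unknown. -/
theorem exists_contDiffOn_implicit {g : X × Q → Q} {s : Set (X × Q)} (hs : IsOpen s)
    {x₀ : X} {q₀ : Q} (h₀ : (x₀, q₀) ∈ s) (hg : ContDiffOn ℝ ∞ g s) (hg₀ : g (x₀, q₀) = 0)
    (hD : ∀ q, fderiv ℝ g (x₀, q₀) (0, q) = q) :
    ∃ (W : Set X) (φ : X → Q), IsOpen W ∧ x₀ ∈ W ∧ ContDiffOn ℝ ∞ φ W ∧ φ x₀ = q₀ ∧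
      ∀ x ∈ W, (x, φ x) ∈ s ∧ g (x, φ x) = 0 := by
  set Φ : X × Q → X × Q := fun z => (z.1, g z) with hΦ
  have hΦs : ContDiffOn ℝ ∞ Φ s := contDiff_fst.contDiffOn.prodMk hg
  have hgd : ∀ z ∈ s, DifferentiableAt ℝ g z := fun z hz =>
    (hg.contDiffAt (hs.mem_nhds hz)).differentiableAt (by simp)
  have hΦ' : HasFDerivAt Φ (shearEquiv (fderiv ℝ g (x₀, q₀)) : X × Q →L[ℝ] X × Q) (x₀, q₀) := by
    have h1 := (hasFDerivAt_fst (𝕜 := ℝ) (p := (x₀, q₀))).prodMk (hgd _ h₀).hasFDerivAt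
    have h2 : (shearEquiv (fderiv ℝ g (x₀, q₀)) : X × Q →L[ℝ] X × Q)
        = (ContinuousLinearMap.fst ℝ X Q).prod (fderiv ℝ g (x₀, q₀)) := by
      refine ContinuousLinearMap.ext fun z => Prod.ext rfl ?_
      have h3 : fderiv ℝ g (x₀, q₀) z
          = fderiv ℝ g (x₀, q₀) (z.1, 0) + fderiv ℝ g (x₀, q₀) (0, z.2) := by
        rw [← map_add]; simp
      rw [hD] at h3
      exact h3.symm
    rw [h2]
    exact h1
  have hcd₀ : ContDiffAt ℝ ∞ Φ (x₀, q₀) := hΦs.contDiffAt (hs.mem_nhds h₀)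
  have hst := hcd₀.hasStrictFDerivAt' hΦ' (by simp)
  set e := hst.toOpenPartialHomeomorph Φ with he
  have hecoe : (e : X × Q → X × Q) = Φ := hst.toOpenPartialHomeomorph_coe
  have hmem₀ : (x₀, q₀) ∈ e.source := hst.mem_toOpenPartialHomeomorph_source
  have hfc : ContinuousOn (fderiv ℝ Φ) s := hΦs.continuousOn_fderiv_of_isOpen hs (by simp)
  -- The local inverse is smooth wherever the derivative of `Φ` is invertible. This is an open
  -- condition, which yields smoothness on a neighbourhood.
  set good : Set (X × Q) := s ∩ fderiv ℝ Φ ⁻¹' (Set.range ((↑) : ((X × Q) ≃L[ℝ] (X × Q)) → _))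
  have hgood : IsOpen good := hfc.isOpen_inter_preimage hs ContinuousLinearEquiv.isOpen
  have hgood₀ : (x₀, q₀) ∈ good := ⟨h₀, ⟨_, hΦ'.fderiv.symm⟩⟩
  have hopen := e.symm.isOpen_inter_preimage hgood
  have hΦ₀ : Φ (x₀, q₀) = (x₀, 0) := by simp [hΦ, hg₀]
  have hsymm₀ : e.symm (x₀, 0) = (x₀, q₀) := by
    rw [← hΦ₀, ← hecoe, e.left_inv hmem₀]
  have hcont : Continuous fun x : X => (x, (0 : Q)) := by fun_prop
  refine ⟨(fun x : X => (x, (0 : Q))) ⁻¹' (e.symm.source ∩ e.symm ⁻¹' good),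
    fun x => (e.symm (x, 0)).2, hopen.preimage hcont, ?_, ?_, ?_, ?_⟩
  · refine ⟨?_, ?_⟩
    · have := e.map_source hmem₀
      rw [hecoe, hΦ₀] at this
      exact this
    · simpa [hsymm₀] using hgood₀
  · intro x hx
    obtain ⟨hx1, hx2, L, hL⟩ := hx
    have hc : ContDiffAt ℝ ∞ Φ (e.symm (x, 0)) := hΦs.contDiffAt (hs.mem_nhds hx2)
    have hd : HasFDerivAt e (L : X × Q →L[ℝ] X × Q) (e.symm (x, 0)) := by
      rw [hecoe, hL]
      exact (hc.differentiableAt (by simp)).hasFDerivAt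
    have h3 : ContDiffAt ℝ ∞ e.symm (x, 0) := e.contDiffAt_symm hx1 hd (by rw [hecoe]; exact hc)
    exact (contDiffAt_snd.comp x (h3.comp x (by fun_prop))).contDiffWithinAt
  · simp [hsymm₀]
  · intro x hx
    obtain ⟨hx1, hx2, -⟩ := hx
    have h1 : Φ (e.symm (x, 0)) = (x, 0) := by rw [← hecoe]; exact e.right_inv hx1
    have h2 : (e.symm (x, 0)).1 = x := congrArg Prod.fst h1
    have h3 : g (e.symm (x, 0)) = 0 := congrArg Prod.snd h1
    have h4 : (x, (e.symm (x, 0)).2) = e.symm (x, 0) := Prod.ext h2.symm rfl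
    rw [h4]
    exact ⟨hx2, h3⟩

end Implicit

/-! ### Lagrangian frames and the differential inequality. -/

variable {E : Type*} [NormedAddCommGroup E] [NormedSpace ℝ E]

/-- A local model, in a chart `Ω` around the identity, of the adjoint representation of a Lie
group with bracket `B`: `T a` is the adjoint operator of the point with coordinate `a`, `Ti a` its
inverse, and `ε` the left Maurer-Cartan form. -/
structure AdjointChart (B : E →L[ℝ] E →L[ℝ] E) (T Ti ε : E → E →L[ℝ] E) (Ω : Set E) : Prop where
  isOpen : IsOpen Ω
  zero_mem : (0 : E) ∈ Ω
  skew : ∀ X Y, B X Y = -B Y X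
  smooth_T : ContDiffOn ℝ ∞ T Ω
  smooth_Ti : ContDiffOn ℝ ∞ Ti Ω
  smooth_ε : ContDiffOn ℝ ∞ ε Ω
  T_zero : ∀ v, T 0 v = v
  ε_zero : ∀ v, ε 0 v = v
  T_Ti : ∀ a ∈ Ω, ∀ v, T a (Ti a v) = v
  Ti_T : ∀ a ∈ Ω, ∀ v, Ti a (T a v) = v
  T_bracket : ∀ a ∈ Ω, ∀ X Y, T a (B X Y) = B (T a X) (T a Y)
  fderiv_T : ∀ a ∈ Ω, ∀ v w, fderiv ℝ T a v w = T a (B (ε a v) w)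
  maurerCartan : ∀ a ∈ Ω, ∀ v w,
    fderiv ℝ ε a v w - fderiv ℝ ε a w v = -B (ε a v) (ε a w)

/-- A frame adapted to a Lagrangian subalgebra `𝔥` at `F`: the `e i` span a complement of `𝔥`, with
coordinates `c`, and the `f j` in `𝔥` are dual to them for the Kirillov form at `F`. -/
structure LagrangianFrame (B : E →L[ℝ] E →L[ℝ] E) (F : E →L[ℝ] ℝ) (𝔥 : Submodule ℝ E) {n : ℕ}
    (e f : Fin n → E) (c : E →L[ℝ] (Fin n → ℝ)) : Prop where
  f_mem : ∀ j, f j ∈ 𝔥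
  c_e : ∀ i, c (e i) = Pi.single i 1
  mem_iff : ∀ v, v ∈ 𝔥 ↔ c v = 0
  pairing : ∀ i j, F (B (e i) (f j)) = if i = j then 1 else 0
  bracket_mem : ∀ X ∈ 𝔥, ∀ Y ∈ 𝔥, B X Y ∈ 𝔥
  isotropic : ∀ X ∈ 𝔥, ∀ Y ∈ 𝔥, F (B X Y) = 0
  stab_le : ∀ Z, (∀ Y, F (B Z Y) = 0) → Z ∈ 𝔥
  stab_of_mem : ∀ Z ∈ 𝔥, (∀ i, F (B (e i) Z) = 0) → ∀ Y, F (B Z Y) = 0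

/-- The linear combinations of the vectors `e i`. -/
def frameSum {n : ℕ} (e : Fin n → E) : (Fin n → ℝ) →L[ℝ] E :=
  ∑ i, (ContinuousLinearMap.proj (R := ℝ) (φ := fun _ : Fin n => ℝ) i).smulRight (e i)

@[simp] lemma frameSum_apply {n : ℕ} (e : Fin n → E) (d : Fin n → ℝ) :
    frameSum e d = ∑ i, d i • e i := by
  simp [frameSum]

/-- The matrix of the Kirillov form at `y` between the two parts of a frame. -/
def pairingMap {n : ℕ} (B : E →L[ℝ] E →L[ℝ] E) (e f : Fin n → E) (y : E →L[ℝ] ℝ) :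
    (Fin n → ℝ) →L[ℝ] (Fin n → ℝ) :=
  ContinuousLinearMap.pi fun j => y ∘L B.flip (f j) ∘L frameSum e

lemma pairingMap_apply {n : ℕ} (B : E →L[ℝ] E →L[ℝ] E) (e f : Fin n → E) (y : E →L[ℝ] ℝ)
    (d : Fin n → ℝ) (j : Fin n) : pairingMap B e f y d j = y (B (frameSum e d) (f j)) := rfl

lemma continuous_pairingMap {n : ℕ} (B : E →L[ℝ] E →L[ℝ] E) (e f : Fin n → E) :
    Continuous (pairingMap B e f) := by
  let L : (E →L[ℝ] ℝ) →L[ℝ] ((Fin n → ℝ) →L[ℝ] (Fin n → ℝ)) :=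
    ∑ j, (ContinuousLinearMap.compL ℝ (Fin n → ℝ) ℝ (Fin n → ℝ)
      (ContinuousLinearMap.single ℝ (fun _ : Fin n => ℝ) j)) ∘L
      (ContinuousLinearMap.compL ℝ (Fin n → ℝ) E ℝ).flip (B.flip (f j) ∘L frameSum e)
  have h : pairingMap B e f = L := by
    funext y
    ext d j
    simp [L, pairingMap_apply, Finset.sum_apply, Pi.single_apply]
  rw [h]
  exact L.continuous

/-- The projection onto `𝔥` along the complement spanned by the `e i`. -/
def projPol {n : ℕ} (e : Fin n → E) (c : E →L[ℝ] (Fin n → ℝ)) : E →L[ℝ] E :=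
  ContinuousLinearMap.id ℝ E - frameSum e ∘L c

/-- The projection onto the stabilizer of `F` along the span of a frame. -/
def projStab {n : ℕ} (B : E →L[ℝ] E →L[ℝ] E) (F : E →L[ℝ] ℝ) (e f : Fin n → E)
    (c : E →L[ℝ] (Fin n → ℝ)) : E →L[ℝ] E :=
  projPol e c - ∑ j, (F ∘L B (e j) ∘L projPol e c).smulRight (f j)

lemma projStab_apply {n : ℕ} (B : E →L[ℝ] E →L[ℝ] E) (F : E →L[ℝ] ℝ) (e f : Fin n → E)
    (c : E →L[ℝ] (Fin n → ℝ)) (v : E) :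
    projStab B F e f c v = projPol e c v - ∑ j, F (B (e j) (projPol e c v)) • f j := by
  simp [projStab]

lemma projPol_apply {n : ℕ} (e : Fin n → E) (c : E →L[ℝ] (Fin n → ℝ)) (v : E) :
    projPol e c v = v - frameSum e (c v) := by
  simp [projPol]

namespace LagrangianFrame

variable {B : E →L[ℝ] E →L[ℝ] E} {F : E →L[ℝ] ℝ} {𝔥 : Submodule ℝ E} {n : ℕ}
  {e f : Fin n → E} {c : E →L[ℝ] (Fin n → ℝ)}

lemma c_frameSum (fr : LagrangianFrame B F 𝔥 e f c) (d : Fin n → ℝ) : c (frameSum e d) = d := by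
  rw [frameSum_apply, map_sum]
  simp_rw [map_smul, fr.c_e]
  ext j
  simp [Finset.sum_apply, Pi.single_apply]

lemma projPol_mem (fr : LagrangianFrame B F 𝔥 e f c) (v : E) : projPol e c v ∈ 𝔥 := by
  rw [fr.mem_iff, projPol_apply, map_sub, fr.c_frameSum, sub_self]

lemma projPol_of_mem (fr : LagrangianFrame B F 𝔥 e f c) {v : E} (hv : v ∈ 𝔥) :
    projPol e c v = v := by
  rw [projPol_apply, (fr.mem_iff v).1 hv, map_zero, sub_zero]

lemma pairingMap_self (fr : LagrangianFrame B F 𝔥 e f c) :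
    pairingMap B e f F = ContinuousLinearMap.id ℝ _ := by
  ext d j
  simp [pairingMap_apply, fr.pairing]

lemma projStab_mem (fr : LagrangianFrame B F 𝔥 e f c) (v : E) : projStab B F e f c v ∈ 𝔥 := by
  rw [projStab_apply]
  exact 𝔥.sub_mem (fr.projPol_mem v) (𝔥.sum_mem fun j _ => 𝔥.smul_mem _ (fr.f_mem j))

/-- Subtracting the `f j` with these coefficients cancels the pairings with the `e i` by duality,
and isotropy handles the pairings with `𝔥`. -/
lemma projStab_stab (fr : LagrangianFrame B F 𝔥 e f c) (v Y : E) :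
    F (B (projStab B F e f c v) Y) = 0 := by
  refine fr.stab_of_mem _ (fr.projStab_mem v) (fun i => ?_) Y
  rw [projStab_apply]
  simp [map_sub, map_sum, fr.pairing]

lemma projStab_of_stab (fr : LagrangianFrame B F 𝔥 e f c) (skew : ∀ X Y, B X Y = -B Y X) {Z : E}
    (hZ : ∀ Y, F (B Z Y) = 0) : projStab B F e f c Z = Z := by
  rw [projStab_apply, fr.projPol_of_mem (fr.stab_le Z hZ)]
  have : ∀ j, F (B (e j) Z) = 0 := fun j => by rw [skew, map_neg, hZ, neg_zero]
  simp [this]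

/-- The two projections differ by a combination of the `f j`, on which `y (B X ·)` vanishes. -/
lemma apply_projStab {y : E →L[ℝ] ℝ} {X : E}
    (h : ∀ j, y (B X (f j)) = 0) (v : E) :
    y (B X (projStab B F e f c v)) = y (B X (projPol e c v)) := by
  rw [projStab_apply]
  simp [map_sub, map_sum, h]

/-- An operator within `1/2` of the identity shrinks no vector by more than a factor `2`. -/
lemma norm_le_two_mul_pairingMap {y : E →L[ℝ] ℝ}
    (hM : ‖pairingMap B e f y - ContinuousLinearMap.id ℝ _‖ ≤ 1 / 2) (d : Fin n → ℝ) :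
    ‖d‖ ≤ 2 * ‖pairingMap B e f y d‖ := by
  have h1 := (pairingMap B e f y - ContinuousLinearMap.id ℝ (Fin n → ℝ)).le_of_opNorm_le hM d
  have h2 : d = pairingMap B e f y d
      - (pairingMap B e f y - ContinuousLinearMap.id ℝ (Fin n → ℝ)) d := by
    simp
  have h3 : ‖d‖ ≤ ‖pairingMap B e f y d‖
      + ‖(pairingMap B e f y - ContinuousLinearMap.id ℝ (Fin n → ℝ)) d‖ := by
    conv_lhs => rw [h2]
    exact norm_sub_le _ _
  linarith

/-- If the restriction of `y` to `𝔥` is orthogonal to `f`-brackets with `X`, and the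
pairing at `y` is nondegenerate, then `X` lies in `𝔥` as soon as `y` and `F` agree on `𝔥`. -/
lemma mem_of_orthogonal (fr : LagrangianFrame B F 𝔥 e f c) {y : E →L[ℝ] ℝ}
    (hM : ‖pairingMap B e f y - ContinuousLinearMap.id ℝ _‖ ≤ 1 / 2)
    (hy : ∀ v ∈ 𝔥, y v = F v) {X : E} (h : ∀ j, y (B X (f j)) = 0) : X ∈ 𝔥 := by
  rw [fr.mem_iff, ← norm_le_zero_iff]
  refine (norm_le_two_mul_pairingMap hM (c X)).trans ?_
  have : pairingMap B e f y (c X) = 0 := by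
    ext j
    have h1 : frameSum e (c X) = X - projPol e c X := by rw [projPol_apply]; abel
    rw [pairingMap_apply, h1, map_sub, sub_apply, map_sub, h,
      hy _ (fr.bracket_mem _ (fr.projPol_mem X) _ (fr.f_mem j)),
      fr.isotropic _ (fr.projPol_mem X) _ (fr.f_mem j)]
    simp
  simp [this]

/-- The differential inequality behind the propagation of `y = F` on `𝔥`. -/
lemma exists_bound (fr : LagrangianFrame B F 𝔥 e f c) (skew : ∀ X Y, B X Y = -B Y X) :
    ∃ C : ℝ, 0 ≤ C ∧ ∀ (y : E →L[ℝ] ℝ) (X : E) (R : E →L[ℝ] E),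
      ‖y‖ ≤ ‖F‖ + 1 → ‖pairingMap B e f y - ContinuousLinearMap.id ℝ _‖ ≤ 1 / 2 →
      ‖R‖ ≤ 2 → ‖ContinuousLinearMap.id ℝ E - R‖ * ‖projStab B F e f c‖ ≤ 1 / 2 →
      (∀ j, y (B X (f j)) = 0) →
      (∀ Z, (∀ Y, F (B Z Y) = 0) → ∀ Y, y (B (R Z) Y) = 0) →
      ‖y ∘L B X ∘L projPol e c‖ ≤ C * ‖X‖ * ‖(y - F) ∘L projPol e c‖ := by
  set P := projStab B F e f c with hP
  set π := projPol e c with hπ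
  set D := ∑ j, ‖f j‖ with hD
  have hD0 : 0 ≤ D := Finset.sum_nonneg fun j _ => norm_nonneg _
  -- `C₁` controls the pairing of the `e`-component of `R Z`, its inner `2` being the bound on
  -- `‖R‖`. `C₂` controls what that component contributes to `ψ`.
  set C₁ := ‖B‖ * (‖π‖ * (2 * ‖P‖)) * D with hC₁
  have hC₁0 : 0 ≤ C₁ := by positivity
  set C₂ := (‖F‖ + 1) * (‖B‖ * ‖frameSum e‖ * (2 * C₁)) with hC₂
  have hC₂0 : 0 ≤ C₂ := by positivity
  refine ⟨2 * C₂, by positivity, ?_⟩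
  intro y X R hy hM hR hRP hX hrad
  set δ := (y - F) ∘L π with hδ
  set ψ := y ∘L B X ∘L π with hψ
  have hψP : ∀ v, ψ v = y (B X (P v)) := fun v => (apply_projStab hX v).symm
  have key : ∀ v, ‖ψ v‖ ≤ (‖ψ‖ * (1 / 2) + C₂ * ‖X‖ * ‖δ‖) * ‖v‖ := by
    intro v
    set Z := P v with hZ
    have hZs : ∀ Y, F (B Z Y) = 0 := fr.projStab_stab v
    have hPZ : P Z = Z := fr.projStab_of_stab skew hZs
    have hZn : ‖Z‖ ≤ ‖P‖ * ‖v‖ := P.le_opNorm v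
    have hRZ : ∀ Y, y (B Y (R Z)) = 0 := fun Y => by rw [skew, map_neg, hrad Z hZs, neg_zero]
    set d := c (R Z) with hd
    have hsplit : R Z = frameSum e d + π (R Z) := by rw [hπ, projPol_apply]; abel
    -- `R Z` lies in the radical at `y`, so the pairing of its `e`-component is minus `y` on a
    -- bracket of elements of `𝔥`. There `F` vanishes, so only `δ` is seen.
    have hpair : ‖pairingMap B e f y d‖ ≤ C₁ * ‖δ‖ * ‖v‖ := by
      rw [pi_norm_le_iff_of_nonneg (by positivity)]
      intro j
      have h1 : pairingMap B e f y d j = -δ (B (π (R Z)) (f j)) := by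
        have h2 : frameSum e d = R Z - π (R Z) := by rw [eq_sub_iff_add_eq, ← hsplit]
        have h3 := fr.bracket_mem _ (fr.projPol_mem (R Z)) _ (fr.f_mem j)
        have h4 : y (B (R Z) (f j)) = 0 := hrad Z hZs (f j)
        rw [pairingMap_apply, h2, map_sub, sub_apply, map_sub, h4, hδ,
          ContinuousLinearMap.comp_apply, hπ, fr.projPol_of_mem h3, sub_apply,
          fr.isotropic _ (fr.projPol_mem (R Z)) _ (fr.f_mem j)]
        ring
      rw [h1, norm_neg]
      have hfD : ‖f j‖ ≤ D :=
        Finset.single_le_sum (f := fun j => ‖f j‖) (fun j _ => norm_nonneg _) (Finset.mem_univ j)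
      have h5 : ‖π (R Z)‖ ≤ ‖π‖ * (2 * (‖P‖ * ‖v‖)) := by
        refine (π.le_opNorm _).trans ?_
        gcongr
        refine (R.le_opNorm _).trans ?_
        gcongr
      calc ‖δ (B (π (R Z)) (f j))‖ ≤ ‖δ‖ * (‖B‖ * ‖π (R Z)‖ * ‖f j‖) := by
            refine (δ.le_opNorm _).trans ?_
            gcongr
            exact B.le_opNorm₂ _ _
        _ ≤ ‖δ‖ * (‖B‖ * (‖π‖ * (2 * (‖P‖ * ‖v‖))) * D) := by gcongr
        _ = C₁ * ‖δ‖ * ‖v‖ := by rw [hC₁]; ring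
    have hdn : ‖d‖ ≤ 2 * (C₁ * ‖δ‖ * ‖v‖) :=
      (norm_le_two_mul_pairingMap hM d).trans (by gcongr)
    -- Since `y (B X (R Z)) = 0`, replacing `Z` by `R Z` leaves a term of size `‖ψ‖ / 2` and one of
    -- order `δ`. The former is absorbed at the end, at the cost of doubling `C₂`.
    have hψv : ψ v = ψ ((ContinuousLinearMap.id ℝ E - R) Z) - y (B X (frameSum e d)) := by
      have h1 : ψ (R Z) = -y (B X (frameSum e d)) := by
        have h2 : y (B X (R Z)) = 0 := hRZ X
        rw [hsplit, map_add, map_add] at h2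
        have h3 : ψ (R Z) = y (B X (π (R Z))) := rfl
        rw [h3]; linarith
      have h4 : ψ Z = ψ v := by rw [hψP, hψP, hPZ]
      rw [sub_apply, map_sub, h1, ContinuousLinearMap.id_apply, h4]
      ring
    rw [hψv]
    refine (norm_sub_le _ _).trans ?_
    rw [add_mul]
    refine add_le_add ?_ ?_
    · calc ‖ψ ((ContinuousLinearMap.id ℝ E - R) Z)‖
          ≤ ‖ψ‖ * (‖ContinuousLinearMap.id ℝ E - R‖ * (‖P‖ * ‖v‖)) := by
            refine (ψ.le_opNorm _).trans ?_
            gcongr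
            refine (ContinuousLinearMap.le_opNorm _ _).trans ?_
            gcongr
        _ = ‖ψ‖ * (‖ContinuousLinearMap.id ℝ E - R‖ * ‖P‖) * ‖v‖ := by ring
        _ ≤ ‖ψ‖ * (1 / 2) * ‖v‖ := by gcongr
    · calc ‖y (B X (frameSum e d))‖
          ≤ (‖F‖ + 1) * (‖B‖ * ‖X‖ * (‖frameSum e‖ * (2 * (C₁ * ‖δ‖ * ‖v‖)))) := by
            refine (y.le_opNorm _).trans ?_
            gcongr
            refine (B.le_opNorm₂ _ _).trans ?_
            gcongr
            refine (ContinuousLinearMap.le_opNorm _ _).trans ?_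
            gcongr
        _ = C₂ * ‖X‖ * ‖δ‖ * ‖v‖ := by rw [hC₂]; ring
  have := ψ.opNorm_le_bound (by positivity) key
  linarith

end LagrangianFrame

end

/-! ### Leaf parameter and propagation of `y = F` on the polarization. -/

section

variable {E : Type*} [NormedAddCommGroup E] [NormedSpace ℝ E]

namespace AdjointChart

variable {B : E →L[ℝ] E →L[ℝ] E} {T Ti ε : E → E →L[ℝ] E} {Ω : Set E}

lemma Ti_bracket (hA : AdjointChart B T Ti ε Ω) {a : E} (ha : a ∈ Ω) (X Y : E) :
    Ti a (B X Y) = B (Ti a X) (Ti a Y) := by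
  rw [← hA.Ti_T a ha (B (Ti a X) (Ti a Y)), hA.T_bracket a ha, hA.T_Ti a ha, hA.T_Ti a ha]

lemma Ti_zero (hA : AdjointChart B T Ti ε Ω) (v : E) : Ti 0 v = v := by
  have := hA.T_Ti 0 hA.zero_mem v
  rwa [hA.T_zero] at this

lemma differentiableAt_T (hA : AdjointChart B T Ti ε Ω) {a : E} (ha : a ∈ Ω) :
    DifferentiableAt ℝ T a :=
  (hA.smooth_T.contDiffAt (hA.isOpen.mem_nhds ha)).differentiableAt (by simp)

lemma differentiableAt_Ti (hA : AdjointChart B T Ti ε Ω) {a : E} (ha : a ∈ Ω) :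
    DifferentiableAt ℝ Ti a :=
  (hA.smooth_Ti.contDiffAt (hA.isOpen.mem_nhds ha)).differentiableAt (by simp)

lemma differentiableAt_ε (hA : AdjointChart B T Ti ε Ω) {a : E} (ha : a ∈ Ω) :
    DifferentiableAt ℝ ε a :=
  (hA.smooth_ε.contDiffAt (hA.isOpen.mem_nhds ha)).differentiableAt (by simp)

/-- Differentiate `T ∘ Ti = 1` and cancel `T`. -/
lemma fderiv_Ti (hA : AdjointChart B T Ti ε Ω) {a : E} (ha : a ∈ Ω) (v w : E) :
    fderiv ℝ Ti a v w = -B (ε a v) (Ti a w) := by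
  have h1 := (hA.differentiableAt_T ha).hasFDerivAt.clm_comp (hA.differentiableAt_Ti ha).hasFDerivAt
  have h2 : HasFDerivAt (fun b => T b ∘L Ti b) (0 : E →L[ℝ] E →L[ℝ] E) a := by
    refine (hasFDerivAt_const (ContinuousLinearMap.id ℝ E) a).congr_of_eventuallyEq ?_
    filter_upwards [hA.isOpen.mem_nhds ha] with b hb
    ext w
    exact hA.T_Ti b hb w
  have h3 := congrArg (fun L : E →L[ℝ] E →L[ℝ] E => L v w) (h1.unique h2)
  simp only [add_apply, ContinuousLinearMap.comp_apply, ContinuousLinearMap.compL_apply,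
    ContinuousLinearMap.flip_apply, zero_apply, hA.fderiv_T a ha] at h3
  have h4 := congrArg (Ti a) h3
  rw [map_add, hA.Ti_T a ha, hA.Ti_T a ha, map_zero] at h4
  exact eq_neg_of_add_eq_zero_left h4

end AdjointChart

/-- The point `y` of the leaf of `F` corresponding to `x`, when `x` lies on the leaf with parameter
`q x`. -/
def leafPoint {n : ℕ} (T : E → E →L[ℝ] E) (e : Fin n → E) (q : (E →L[ℝ] ℝ) → Fin n → ℝ)
    (x : E →L[ℝ] ℝ) : E →L[ℝ] ℝ :=
  x ∘L T (frameSum e (q x))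

/-- The part of the direction `X` at `x` that is tangent to the leaf, brought back to `F`. -/
def leafDir {n : ℕ} (B : E →L[ℝ] E →L[ℝ] E) (Ti ε : E → E →L[ℝ] E) (e : Fin n → E)
    (q : (E →L[ℝ] ℝ) → Fin n → ℝ) (x : E →L[ℝ] ℝ) (X : E) : E :=
  Ti (frameSum e (q x)) X - ε (frameSum e (q x)) (frameSum e (fderiv ℝ q x (-(x ∘L B X))))

/-- The change of complement of the polarization along the transversal. -/
def frameChange {n : ℕ} (ε : E → E →L[ℝ] E) (e : Fin n → E) (c : E →L[ℝ] (Fin n → ℝ))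
    (d : Fin n → ℝ) : E →L[ℝ] E :=
  ε (frameSum e d) ∘L frameSum e ∘L c + projPol e c

/-- A function `q` on a neighbourhood `W` of `F` in the dual space which parametrizes the leaves
of the polarization. -/
structure LeafParameter {n : ℕ} (B : E →L[ℝ] E →L[ℝ] E) (T ε : E → E →L[ℝ] E) (Ω : Set E)
    (F : E →L[ℝ] ℝ) (e f : Fin n → E) (c : E →L[ℝ] (Fin n → ℝ)) (W : Set (E →L[ℝ] ℝ))
    (q : (E →L[ℝ] ℝ) → Fin n → ℝ) : Prop where
  isOpen : IsOpen W
  mem : F ∈ W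
  smooth : ContDiffOn ℝ ∞ q W
  map_self : q F = 0
  mem_chart : ∀ x ∈ W, frameSum e (q x) ∈ Ω
  eqn : ∀ x ∈ W, ∀ j, leafPoint T e q x (f j) = F (f j)
  pairing_le : ∀ x ∈ W,
    ‖pairingMap B e f (leafPoint T e q x) - ContinuousLinearMap.id ℝ (Fin n → ℝ)‖ ≤ 1 / 2
  norm_le : ∀ x ∈ W, ‖leafPoint T e q x‖ ≤ ‖F‖ + 1
  isUnit : ∀ x ∈ W, IsUnit (frameChange ε e c (q x))

section

variable {B : E →L[ℝ] E →L[ℝ] E} {T Ti ε : E → E →L[ℝ] E} {Ω : Set E}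
  {F : E →L[ℝ] ℝ} {𝔥 : Submodule ℝ E} {n : ℕ} {e f : Fin n → E} {c : E →L[ℝ] (Fin n → ℝ)}

lemma contDiffOn_frameChange (hA : AdjointChart B T Ti ε Ω) :
    ContDiffOn ℝ ∞ (frameChange ε e c) (frameSum e ⁻¹' Ω) := by
  have h1 : ContDiffOn ℝ ∞ (fun d => ε (frameSum e d)) (frameSum e ⁻¹' Ω) :=
    hA.smooth_ε.comp (frameSum e).contDiff.contDiffOn fun _ h => h
  exact (h1.clm_comp contDiffOn_const).add contDiffOn_const

lemma frameChange_zero (hA : AdjointChart B T Ti ε Ω) :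
    frameChange ε e c 0 = ContinuousLinearMap.id ℝ E := by
  ext v
  simp [frameChange, hA.ε_zero, projPol_apply]

/-- At `(F, 0)` the derivative in the unknown `q` is the pairing matrix at `F`, which duality of the
frame makes the identity. The remaining conditions are open and hold at `F`. -/
theorem exists_leafParameter [FiniteDimensional ℝ E] (hA : AdjointChart B T Ti ε Ω)
    (fr : LagrangianFrame B F 𝔥 e f c) : ∃ W q, LeafParameter B T ε Ω F e f c W q := by
  have : CompleteSpace E := FiniteDimensional.complete ℝ E
  set s : Set ((E →L[ℝ] ℝ) × (Fin n → ℝ)) := {z | frameSum e z.2 ∈ Ω} with hs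
  have hso : IsOpen s := hA.isOpen.preimage ((frameSum e).continuous.comp continuous_snd)
  set g : (E →L[ℝ] ℝ) × (Fin n → ℝ) → Fin n → ℝ :=
    fun z j => z.1 (T (frameSum e z.2) (f j)) - F (f j) with hg
  have h0 : (F, (0 : Fin n → ℝ)) ∈ s := by simpa [hs] using hA.zero_mem
  have hTs : ContDiffOn ℝ ∞
      (fun z : (E →L[ℝ] ℝ) × (Fin n → ℝ) => T (frameSum e z.2)) s :=
    hA.smooth_T.comp ((frameSum e).contDiff.comp contDiff_snd).contDiffOn fun _ h => h
  have hgs : ContDiffOn ℝ ∞ g s := by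
    rw [contDiffOn_pi]
    intro j
    exact (contDiff_fst.contDiffOn.clm_apply (hTs.clm_apply contDiffOn_const)).sub contDiffOn_const
  have hg0 : g (F, 0) = 0 := by
    ext j
    simp [hg, hA.T_zero]
  have hD : ∀ d, fderiv ℝ g (F, 0) (0, d) = d := by
    intro d
    have hgd : DifferentiableAt ℝ g (F, 0) :=
      (hgs.contDiffAt (hso.mem_nhds h0)).differentiableAt (by simp)
    have h1 : HasFDerivAt (fun d : Fin n → ℝ => g (F, d))
        (fderiv ℝ g (F, 0) ∘L ContinuousLinearMap.inr ℝ (E →L[ℝ] ℝ) (Fin n → ℝ)) 0 :=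
      hgd.hasFDerivAt.comp (0 : Fin n → ℝ) (hasFDerivAt_prodMk_right F 0)
    have hz : frameSum e 0 ∈ Ω := by simpa using hA.zero_mem
    have h2 : HasFDerivAt (fun d : Fin n → ℝ => T (frameSum e d))
        (fderiv ℝ T (frameSum e 0) ∘L frameSum e) 0 :=
      (hA.differentiableAt_T hz).hasFDerivAt.comp (0 : Fin n → ℝ) (frameSum e).hasFDerivAt
    ext j
    have h3 := (F.hasFDerivAt.comp (0 : Fin n → ℝ)
      (h2.clm_apply (hasFDerivAt_const (f j) (0 : Fin n → ℝ)))).sub_const (F (f j))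
    have h4 := (hasFDerivAt_pi'.1 h1 j).unique h3
    have h5 := congrArg (fun L : (Fin n → ℝ) →L[ℝ] ℝ => L d) h4
    have h6 : fderiv ℝ g (F, 0) (0, d) j
        = F (fderiv ℝ T (frameSum e 0) (frameSum e d) (f j)) := by
      simpa using h5
    rw [h6, hA.fderiv_T _ hz, map_zero, hA.T_zero, hA.ε_zero]
    have h7 := congrArg (fun L : (Fin n → ℝ) →L[ℝ] (Fin n → ℝ) => L d j) fr.pairingMap_self
    exact h7
  obtain ⟨W, q, hWo, hFW, hq, hqF, hqW⟩ := exists_contDiffOn_implicit hso h0 hgs hg0 hD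
  have hqc : ContinuousOn q W := hq.continuousOn
  have hmaps : Set.MapsTo (fun x => frameSum e (q x)) W Ω := fun x hx => (hqW x hx).1
  have hyc : ContinuousOn (leafPoint T e q) W := by
    have h1 : ContinuousOn (fun x => T (frameSum e (q x))) W :=
      hA.smooth_T.continuousOn.comp ((frameSum e).continuous.comp_continuousOn hqc) hmaps
    exact continuousOn_id.clm_comp h1
  have hyF : leafPoint T e q F = F := by
    ext v
    simp [leafPoint, hqF, hA.T_zero]
  have hLc : ContinuousOn (fun x => frameChange ε e c (q x)) W :=
    (contDiffOn_frameChange hA).continuousOn.comp hqc hmaps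
  have hMc : ContinuousOn (fun x => ‖pairingMap B e f (leafPoint T e q x)
      - ContinuousLinearMap.id ℝ (Fin n → ℝ)‖) W :=
    (((continuous_pairingMap B e f).comp_continuousOn hyc).sub continuousOn_const).norm
  -- Strict forms of the bounds cut out open sets; at `F` the three quantities are `0`, `‖F‖` and
  -- the identity.
  set W₁ := W ∩ (fun x => ‖pairingMap B e f (leafPoint T e q x)
      - ContinuousLinearMap.id ℝ (Fin n → ℝ)‖) ⁻¹' Set.Iio (1 / 2) with hW₁
  set W₂ := W ∩ (fun x => ‖leafPoint T e q x‖) ⁻¹' Set.Iio (‖F‖ + 1) with hW₂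
  set W₃ := W ∩ (fun x => frameChange ε e c (q x)) ⁻¹' {L | IsUnit L} with hW₃
  have ho₁ : IsOpen W₁ := hMc.isOpen_inter_preimage hWo isOpen_Iio
  have ho₂ : IsOpen W₂ := hyc.norm.isOpen_inter_preimage hWo isOpen_Iio
  have ho₃ : IsOpen W₃ := hLc.isOpen_inter_preimage hWo Units.isOpen
  refine ⟨W₁ ∩ W₂ ∩ W₃, q, (ho₁.inter ho₂).inter ho₃, ⟨⟨⟨hFW, ?_⟩, hFW, ?_⟩, hFW, ?_⟩,
    hq.mono fun x hx => hx.2.1, hqF, fun x hx => (hqW x hx.2.1).1, fun x hx j => ?_,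
    fun x hx => hx.1.1.2.le, fun x hx => hx.1.2.2.le, fun x hx => hx.2.2⟩
  · simp [hyF, fr.pairingMap_self]
  · simp [hyF]
  · simp only [Set.mem_preimage, hqF, frameChange_zero hA, Set.mem_ofPred_eq]
    exact isUnit_one
  · have := congrFun (hqW x hx.2.1).2 j
    simpa [hg, leafPoint, sub_eq_zero] using this

variable {W : Set (E →L[ℝ] ℝ)} {q : (E →L[ℝ] ℝ) → Fin n → ℝ}

namespace LeafParameter

lemma differentiableAt (hq : LeafParameter B T ε Ω F e f c W q) {x : E →L[ℝ] ℝ} (hx : x ∈ W) :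
    DifferentiableAt ℝ q x :=
  (hq.smooth.contDiffAt (hq.isOpen.mem_nhds hx)).differentiableAt (by simp)

/-- Product rule for `x ∘ T(s(x))` along `ξ_X = -x ∘ B X`. Moving `x` contributes `Ti X`, and moving
`s` contributes the Maurer-Cartan form with the opposite sign. -/
lemma exists_hasFDerivAt_leafPoint (hq : LeafParameter B T ε Ω F e f c W q)
    (hA : AdjointChart B T Ti ε Ω) {x : E →L[ℝ] ℝ} (hx : x ∈ W) :
    ∃ L : (E →L[ℝ] ℝ) →L[ℝ] (E →L[ℝ] ℝ), HasFDerivAt (leafPoint T e q) L x ∧ ∀ X,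
      L (-(x ∘L B X)) = -(leafPoint T e q x ∘L B (leafDir B Ti ε e q x X)) := by
  have hm := hq.mem_chart x hx
  have h1 : HasFDerivAt (fun x => T (frameSum e (q x)))
      (fderiv ℝ T (frameSum e (q x)) ∘L frameSum e ∘L fderiv ℝ q x) x :=
    (hA.differentiableAt_T hm).hasFDerivAt.comp x
      ((frameSum e).hasFDerivAt.comp x (hq.differentiableAt hx).hasFDerivAt)
  refine ⟨_, (hasFDerivAt_id x).clm_comp h1, fun X => ?_⟩
  ext v
  simp only [add_apply, ContinuousLinearMap.comp_apply, ContinuousLinearMap.compL_apply,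
    ContinuousLinearMap.flip_apply, neg_apply, ContinuousLinearMap.id_apply, id_eq, leafDir,
    leafPoint, hA.fderiv_T _ hm, hA.T_bracket _ hm, map_sub, sub_apply, hA.T_Ti _ hm]
  ring

/-- The value of the leaf point on `f j` is constant on the open set `W`, so its derivative along
`ξ_X` is zero. -/
lemma bracket_leafDir_frame (hq : LeafParameter B T ε Ω F e f c W q)
    (hA : AdjointChart B T Ti ε Ω) {x : E →L[ℝ] ℝ} (hx : x ∈ W) (X : E) (j : Fin n) :
    leafPoint T e q x (B (leafDir B Ti ε e q x X) (f j)) = 0 := by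
  obtain ⟨L, hL, hL'⟩ := hq.exists_hasFDerivAt_leafPoint hA hx
  have h1 := hL.clm_apply (hasFDerivAt_const (f j) x)
  have h2 : HasFDerivAt (fun x => leafPoint T e q x (f j)) (0 : (E →L[ℝ] ℝ) →L[ℝ] ℝ) x := by
    refine (hasFDerivAt_const (F (f j)) x).congr_of_eventuallyEq ?_
    filter_upwards [hq.isOpen.mem_nhds hx] with z hz
    exact hq.eqn z hz j
  have h3 := congrArg (fun K : (E →L[ℝ] ℝ) →L[ℝ] ℝ => K (-(x ∘L B X))) (h1.unique h2)
  simp only [add_apply, ContinuousLinearMap.comp_apply, zero_apply, map_zero, zero_add,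
    ContinuousLinearMap.flip_apply, hL', neg_apply, neg_eq_zero] at h3
  exact h3

/-- Along a ray in the chart, the leaf point keeps agreeing with `F` on the polarization. -/
lemma leafPoint_eq_of_ray [FiniteDimensional ℝ E] (hq : LeafParameter B T ε Ω F e f c W q)
    (hA : AdjointChart B T Ti ε Ω) (fr : LagrangianFrame B F 𝔥 e f c) {a : E}
    (ha : ∀ t ∈ Set.Icc (0 : ℝ) 1, t • a ∈ Ω ∧ F ∘L Ti (t • a) ∈ W ∧
      ‖Ti (frameSum e (q (F ∘L Ti (t • a)))) ∘L T (t • a)‖ ≤ 2 ∧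
      ‖ContinuousLinearMap.id ℝ E - Ti (frameSum e (q (F ∘L Ti (t • a)))) ∘L T (t • a)‖
        * ‖projStab B F e f c‖ ≤ 1 / 2) :
    ∀ v ∈ 𝔥, leafPoint T e q (F ∘L Ti a) v = F v := by
  obtain ⟨C, hC0, hC⟩ := fr.exists_bound hA.skew
  set x : ℝ → E →L[ℝ] ℝ := fun t => F ∘L Ti (t • a) with hx
  -- The velocity of `F ∘ Ti (t • a)` is the fundamental field of this element, the right-invariant
  -- form of the velocity of the ray.
  set X : ℝ → E := fun t => T (t • a) (ε (t • a) a) with hX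
  have hline : ∀ t, HasDerivAt (fun t : ℝ => t • a) a t := fun t => by
    simpa using (hasDerivAt_id t).smul_const a
  have hx' : ∀ t ∈ Set.Icc (0 : ℝ) 1, HasDerivAt x (-(x t ∘L B (X t))) t := by
    intro t ht
    have hm := (ha t ht).1
    have h1 : HasDerivAt (fun t : ℝ => Ti (t • a)) (fderiv ℝ Ti (t • a) a) t :=
      (hA.differentiableAt_Ti hm).hasFDerivAt.comp_hasDerivAt t (hline t)
    have h2 := (((ContinuousLinearMap.compL ℝ E E ℝ) F).hasFDerivAt).comp_hasDerivAt t h1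
    have h3 : -(x t ∘L B (X t)) = ContinuousLinearMap.compL ℝ E E ℝ F (fderiv ℝ Ti (t • a) a) := by
      ext v
      simp [hx, hX, hA.fderiv_Ti hm, hA.Ti_bracket hm, hA.Ti_T _ hm]
    rw [h3]
    exact h2
  set D : ℝ → E := fun t => leafDir B Ti ε e q (x t) (X t) with hDdef
  set δ : ℝ → E →L[ℝ] ℝ := fun t => (leafPoint T e q (x t) - F) ∘L projPol e c with hδ
  have hδ' : ∀ t ∈ Set.Icc (0 : ℝ) 1,
      HasDerivAt δ (-(leafPoint T e q (x t) ∘L B (D t) ∘L projPol e c)) t := by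
    intro t ht
    obtain ⟨L, hL, hL'⟩ := hq.exists_hasFDerivAt_leafPoint hA (ha t ht).2.1
    have h1 := (hL.comp_hasDerivAt t (hx' t ht)).sub_const F
    have h2 := (((ContinuousLinearMap.compL ℝ E E ℝ).flip
      (projPol e c)).hasFDerivAt).comp_hasDerivAt t h1
    rw [hL'] at h2
    exact h2
  have hxc : ContinuousOn x (Set.Icc 0 1) := fun t ht =>
    (hx' t ht).continuousAt.continuousWithinAt
  have hlc : ContinuousOn (fun t : ℝ => t • a) (Set.Icc 0 1) := by fun_prop
  have hDc : ContinuousOn D (Set.Icc 0 1) := by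
    have hXc : ContinuousOn X (Set.Icc 0 1) :=
      (hA.smooth_T.continuousOn.comp hlc fun t ht => (ha t ht).1).clm_apply
        ((hA.smooth_ε.continuousOn.comp hlc fun t ht => (ha t ht).1).clm_apply continuousOn_const)
    have hxW : Set.MapsTo x (Set.Icc 0 1) W := fun t ht => (ha t ht).2.1
    have hsq : ContinuousOn (fun t => frameSum e (q (x t))) (Set.Icc 0 1) :=
      (frameSum e).continuous.comp_continuousOn (hq.smooth.continuousOn.comp hxc hxW)
    have hsΩ : Set.MapsTo (fun t => frameSum e (q (x t))) (Set.Icc 0 1) Ω :=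
      fun t ht => hq.mem_chart _ (hxW ht)
    have hfd : ContinuousOn (fun t => fderiv ℝ q (x t)) (Set.Icc 0 1) :=
      (hq.smooth.continuousOn_fderiv_of_isOpen hq.isOpen (by simp)).comp hxc hxW
    have hBX : ContinuousOn (fun t => B (X t)) (Set.Icc 0 1) := B.continuous.comp_continuousOn hXc
    exact ((hA.smooth_Ti.continuousOn.comp hsq hsΩ).clm_apply hXc).sub
      ((hA.smooth_ε.continuousOn.comp hsq hsΩ).clm_apply
        ((frameSum e).continuous.comp_continuousOn (hfd.clm_apply (hxc.clm_comp hBX).neg)))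
  obtain ⟨K, hK⟩ := isCompact_Icc.exists_bound_of_continuousOn hDc
  have hδ0 : δ 0 = 0 := by
    have : x 0 = F := by
      ext v
      simp [hx, hA.Ti_zero]
    ext v
    simp [hδ, this, leafPoint, hq.map_self, hA.T_zero]
  -- Grönwall: `C` comes from the differential inequality, and `K` bounds the leaf direction on the
  -- compact interval.
  have hzero := eq_zero_of_abs_deriv_le_mul_abs_self_of_eq_zero_right (K := C * K)
    (fun t ht => (hδ' t ht).continuousAt.continuousWithinAt)
    (fun t ht => (hδ' t (Set.Ico_subset_Icc_self ht)).hasDerivWithinAt) hδ0 (by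
      intro t ht
      have ht' := Set.Ico_subset_Icc_self ht
      obtain ⟨hm, hW, hR, hRP⟩ := ha t ht'
      have hm' := hq.mem_chart _ hW
      rw [norm_neg]
      refine (hC (leafPoint T e q (x t)) (D t) _ (hq.norm_le _ hW) (hq.pairing_le _ hW) hR hRP
        (fun j => hq.bracket_leafDir_frame hA hW _ j) ?_).trans ?_
      -- The leaf point is `F` composed with the inverse of the automorphism `R`, so `R` carries the
      -- radical at `F` into the radical at the leaf point.
      · intro Z hZ Y
        simp only [leafPoint, hx, ContinuousLinearMap.comp_apply, hA.T_bracket _ hm',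
          hA.T_Ti _ hm', hA.Ti_bracket hm, hA.Ti_T _ hm, hZ]
      · have := hK t ht'
        gcongr)
  intro v hv
  have h1 := hzero 1 (by simp)
  have h2 := congrArg (fun L : E →L[ℝ] ℝ => L v) h1
  simp only [hδ, hx, one_smul, ContinuousLinearMap.comp_apply, fr.projPol_of_mem hv, sub_apply,
    zero_apply] at h2
  exact sub_eq_zero.1 h2

/-- At `a = 0` the operator `R` is the identity, so the ray hypotheses hold strictly there and
persist on a ball. A ball contains the segment from `0` to each of its points. -/
lemma exists_leafPoint_eq [FiniteDimensional ℝ E] (hq : LeafParameter B T ε Ω F e f c W q)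
    (hA : AdjointChart B T Ti ε Ω) (fr : LagrangianFrame B F 𝔥 e f c) :
    ∃ U : Set E, IsOpen U ∧ 0 ∈ U ∧ ∀ a ∈ U, a ∈ Ω ∧ F ∘L Ti a ∈ W ∧
      ∀ v ∈ 𝔥, leafPoint T e q (F ∘L Ti a) v = F v := by
  set R : E → E →L[ℝ] E := fun a => Ti (frameSum e (q (F ∘L Ti a))) ∘L T a with hR
  have hF0 : F ∘L Ti 0 = F := by
    ext v
    simp [hA.Ti_zero]
  have hR0 : R 0 = ContinuousLinearMap.id ℝ E := by
    ext v
    simp only [hR, hF0, hq.map_self, map_zero, ContinuousLinearMap.comp_apply, hA.Ti_zero,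
      hA.T_zero, ContinuousLinearMap.id_apply]
  have hz := hA.isOpen.mem_nhds hA.zero_mem
  have hTic : ContinuousAt Ti 0 := hA.smooth_Ti.continuousOn.continuousAt hz
  have hxc : ContinuousAt (fun a => F ∘L Ti a) 0 := continuousAt_const.clm_comp hTic
  have hqc : ContinuousAt q (F ∘L Ti 0) := by
    rw [hF0]
    exact hq.smooth.continuousOn.continuousAt (hq.isOpen.mem_nhds hq.mem)
  have hsc : ContinuousAt (fun a => frameSum e (q (F ∘L Ti a))) 0 :=
    (frameSum e).continuous.continuousAt.comp (ContinuousAt.comp hqc hxc)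
  have hRc : ContinuousAt R 0 := by
    refine ContinuousAt.clm_comp (ContinuousAt.comp (g := Ti) ?_ hsc)
      (hA.smooth_T.continuousOn.continuousAt hz)
    simpa [hF0, hq.map_self] using hTic
  have hev : ∀ᶠ a in nhds (0 : E), a ∈ Ω ∧ F ∘L Ti a ∈ W ∧ ‖R a‖ < 2 ∧
      ‖ContinuousLinearMap.id ℝ E - R a‖ * ‖projStab B F e f c‖ < 1 / 2 := by
    refine Filter.Eventually.and hz ((hxc.eventually_mem
        (hq.isOpen.mem_nhds (by simpa [hF0] using hq.mem))).and
      ((hRc.norm.eventually_lt continuousAt_const ?_).and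
      (((continuousAt_const.sub hRc).norm.mul continuousAt_const).eventually_lt
        continuousAt_const ?_)))
    · rw [hR0]
      exact ContinuousLinearMap.norm_id_le.trans_lt (by norm_num)
    · simp [hR0]
  obtain ⟨r, hr, hball⟩ := Metric.eventually_nhds_iff_ball.1 hev
  refine ⟨Metric.ball 0 r, Metric.isOpen_ball, Metric.mem_ball_self hr, fun a ha =>
    ⟨(hball a ha).1, (hball a ha).2.1, hq.leafPoint_eq_of_ray hA fr fun t ht => ?_⟩⟩
  have hta : t • a ∈ Metric.ball (0 : E) r := by
    rw [mem_ball_zero_iff] at ha ⊢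
    refine lt_of_le_of_lt ?_ ha
    rw [norm_smul, Real.norm_eq_abs, abs_of_nonneg ht.1]
    exact mul_le_of_le_one_left (norm_nonneg a) ht.2
  obtain ⟨h1, h2, h3, h4⟩ := hball _ hta
  exact ⟨h1, h2, h3.le, h4.le⟩

end LeafParameter

end

end

/-! ### Existence of frames, momenta and Darboux coordinates in the local model. -/

section

variable {E : Type*} [NormedAddCommGroup E] [NormedSpace ℝ E]

/-- The radical of the form `F (B X Y)`. -/
def radical (B : E →L[ℝ] E →L[ℝ] E) (F : E →L[ℝ] ℝ) : Submodule ℝ E :=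
  LinearMap.ker (((ContinuousLinearMap.compL ℝ E E ℝ F) ∘L B : E →L[ℝ] E →L[ℝ] ℝ) :
    E →ₗ[ℝ] E →L[ℝ] ℝ)

lemma mem_radical {B : E →L[ℝ] E →L[ℝ] E} {F : E →L[ℝ] ℝ} {Z : E} :
    Z ∈ radical B F ↔ ∀ Y, F (B Z Y) = 0 := by
  rw [radical, LinearMap.mem_ker]
  exact ContinuousLinearMap.ext_iff

/-- The `e i` lift a basis of the quotient by `𝔥`. The pairing with them maps `𝔥`, of dimension `n +
dim radical`, to `ℝⁿ` with kernel inside the radical. It is therefore onto, and the `f j` are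
preimages of the standard basis. -/
theorem exists_lagrangianFrame [FiniteDimensional ℝ E] {B : E →L[ℝ] E →L[ℝ] E}
    (skew : ∀ X Y, B X Y = -B Y X) {F : E →L[ℝ] ℝ} {𝔥 : Submodule ℝ E} {n : ℕ}
    (bracket_mem : ∀ X ∈ 𝔥, ∀ Y ∈ 𝔥, B X Y ∈ 𝔥)
    (isotropic : ∀ X ∈ 𝔥, ∀ Y ∈ 𝔥, F (B X Y) = 0) (stab_le : radical B F ≤ 𝔥)
    (hn : Module.finrank ℝ (E ⧸ 𝔥) = n)
    (hdim : 2 * n + Module.finrank ℝ (radical B F) = Module.finrank ℝ E) :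
    ∃ (e f : Fin n → E) (c : E →L[ℝ] (Fin n → ℝ)), LagrangianFrame B F 𝔥 e f c := by
  let b := Module.finBasisOfFinrankEq ℝ (E ⧸ 𝔥) hn
  let c : E →L[ℝ] (Fin n → ℝ) :=
    LinearMap.toContinuousLinearMap (b.equivFun.toLinearMap ∘ₗ 𝔥.mkQ)
  have hc : ∀ v, c v = b.equivFun (𝔥.mkQ v) := fun _ => rfl
  choose e he using fun i => 𝔥.mkQ_surjective (b i)
  have hce : ∀ i, c (e i) = Pi.single i 1 := fun i => by
    ext j
    rw [hc, he, Module.Basis.equivFun_self, Pi.single_apply]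
    simp only [eq_comm]
  have hmem : ∀ v, v ∈ 𝔥 ↔ c v = 0 := fun v => by
    rw [hc, LinearEquiv.map_eq_zero_iff, Submodule.mkQ_apply, Submodule.Quotient.mk_eq_zero]
  have hstab : ∀ Z ∈ 𝔥, (∀ i, F (B (e i) Z) = 0) → ∀ Y, F (B Z Y) = 0 := by
    intro Z hZ h Y
    have h1 : Y - frameSum e (c Y) ∈ 𝔥 := by
      rw [hmem, map_sub, frameSum_apply, map_sum, sub_eq_zero]
      ext j
      simp [hce, Finset.sum_apply, Pi.single_apply]
    have h2 : Y = frameSum e (c Y) + (Y - frameSum e (c Y)) := by abel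
    have h3 : ∀ i, F (B Z (e i)) = 0 := fun i => by rw [skew, map_neg, h, neg_zero]
    rw [h2, map_add, map_add, isotropic Z hZ _ h1, frameSum_apply]
    simp [map_sum, h3]
  let g : 𝔥 →ₗ[ℝ] (Fin n → ℝ) :=
    LinearMap.pi fun i => ((F ∘L B (e i) : E →L[ℝ] ℝ) : E →ₗ[ℝ] ℝ) ∘ₗ 𝔥.subtype
  have hg : ∀ Z i, g Z i = F (B (e i) Z) := fun _ _ => rfl
  have hker : Module.finrank ℝ (LinearMap.ker g) ≤ Module.finrank ℝ (radical B F) := by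
    have hle : (LinearMap.ker g).map 𝔥.subtype ≤ radical B F := by
      rintro _ ⟨Z, hZ, rfl⟩
      rw [mem_radical]
      exact hstab Z Z.2 fun i => congrFun (LinearMap.mem_ker.1 hZ) i
    rw [((LinearMap.ker g).equivMapOfInjective 𝔥.subtype 𝔥.injective_subtype).finrank_eq]
    exact Submodule.finrank_mono hle
  have hsurj : Function.Surjective g := by
    rw [← LinearMap.range_eq_top]
    apply Submodule.eq_top_of_finrank_eq
    have h1 := g.finrank_range_add_finrank_ker
    have h2 := 𝔥.finrank_quotient_add_finrank
    have h3 := (LinearMap.range g).finrank_le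
    simp only [Module.finrank_fintype_fun_eq_card, Fintype.card_fin] at h3 ⊢
    omega
  choose f hf using fun j : Fin n => hsurj (Pi.single j 1)
  refine ⟨e, fun j => f j, c, fun j => (f j).2, hce, hmem, fun i j => ?_, bracket_mem, isotropic,
    fun Z hZ => stab_le (mem_radical.2 hZ), hstab⟩
  rw [← hg, hf, Pi.single_apply]

/-- The momenta conjugate to the leaf parameter `q`. -/
def momentum {n : ℕ} (T ε : E → E →L[ℝ] E) (e : Fin n → E) (q : (E →L[ℝ] ℝ) → Fin n → ℝ)
    (x : E →L[ℝ] ℝ) (i : Fin n) : ℝ :=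
  -leafPoint T e q x (ε (frameSum e (q x)) (e i))

section

variable {B : E →L[ℝ] E →L[ℝ] E} {T Ti ε : E → E →L[ℝ] E} {Ω : Set E}
  {F : E →L[ℝ] ℝ} {𝔥 : Submodule ℝ E} {n : ℕ} {e f : Fin n → E} {c : E →L[ℝ] (Fin n → ℝ)}
  {W : Set (E →L[ℝ] ℝ)} {q : (E →L[ℝ] ℝ) → Fin n → ℝ}

namespace LeafParameter

lemma contDiffOn_momentum (hq : LeafParameter B T ε Ω F e f c W q)
    (hA : AdjointChart B T Ti ε Ω) : ContDiffOn ℝ ∞ (momentum T ε e q) W := by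
  have hs : ContDiffOn ℝ ∞ (fun x => frameSum e (q x)) W :=
    (frameSum e).contDiff.comp_contDiffOn hq.smooth
  have hm : Set.MapsTo (fun x => frameSum e (q x)) W Ω := hq.mem_chart
  rw [contDiffOn_pi]
  intro i
  exact ((contDiffOn_id.clm_comp (hA.smooth_T.comp hs hm)).clm_apply
    ((hA.smooth_ε.comp hs hm).clm_apply contDiffOn_const)).neg

/-- The first term comes from moving the leaf point, the second from moving `ε(s)`; antisymmetrised,
the latter will yield the Maurer-Cartan equation. -/
lemma fderiv_momentum (hq : LeafParameter B T ε Ω F e f c W q)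
    (hA : AdjointChart B T Ti ε Ω) {x : E →L[ℝ] ℝ} (hx : x ∈ W) (X : E) (i : Fin n) :
    fderiv ℝ (momentum T ε e q) x (-(x ∘L B X)) i =
      leafPoint T e q x (B (leafDir B Ti ε e q x X) (ε (frameSum e (q x)) (e i)))
      - leafPoint T e q x (fderiv ℝ ε (frameSum e (q x))
          (frameSum e (fderiv ℝ q x (-(x ∘L B X)))) (e i)) := by
  obtain ⟨L, hL, hL'⟩ := hq.exists_hasFDerivAt_leafPoint hA hx
  have h1 : HasFDerivAt (fun x => ε (frameSum e (q x)))
      (fderiv ℝ ε (frameSum e (q x)) ∘L frameSum e ∘L fderiv ℝ q x) x :=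
    (hA.differentiableAt_ε (hq.mem_chart x hx)).hasFDerivAt.comp x
      ((frameSum e).hasFDerivAt.comp x (hq.differentiableAt hx).hasFDerivAt)
  have h2 := (hL.clm_apply (h1.clm_apply (hasFDerivAt_const (e i) x))).neg
  have h3 := ((hq.contDiffOn_momentum hA).contDiffAt (hq.isOpen.mem_nhds hx)).differentiableAt
    (by simp)
  have h4 := congrArg (fun K : (E →L[ℝ] ℝ) →L[ℝ] ℝ => K (-(x ∘L B X)))
    ((hasFDerivAt_pi'.1 h3.hasFDerivAt i).unique h2)
  simp only [ContinuousLinearMap.comp_apply, ContinuousLinearMap.proj_apply, neg_apply, add_apply,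
    ContinuousLinearMap.flip_apply, hL', zero_apply, map_zero, zero_add] at h4
  rw [h4]
  ring

/-- The Kirillov form in the coordinates `q` and `momentum`. -/
lemma darboux (hq : LeafParameter B T ε Ω F e f c W q)
    (hA : AdjointChart B T Ti ε Ω) (fr : LagrangianFrame B F 𝔥 e f c) {x : E →L[ℝ] ℝ}
    (hx : x ∈ W) (hy : ∀ v ∈ 𝔥, leafPoint T e q x v = F v) (X Y : E) :
    x (B X Y) = ∑ i,
      (fderiv ℝ (momentum T ε e q) x (-(x ∘L B X)) i * fderiv ℝ q x (-(x ∘L B Y)) i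
      - fderiv ℝ q x (-(x ∘L B X)) i * fderiv ℝ (momentum T ε e q) x (-(x ∘L B Y)) i) := by
  set y := leafPoint T e q x with hydef
  set s := frameSum e (q x) with hs
  have hsΩ : s ∈ Ω := hq.mem_chart x hx
  set uX := fderiv ℝ q x (-(x ∘L B X)) with huX
  set uY := fderiv ℝ q x (-(x ∘L B Y)) with huY
  set DX := leafDir B Ti ε e q x X with hDX
  set DY := leafDir B Ti ε e q x Y with hDY
  have hsum : ∀ (Z : E) (u : Fin n → ℝ),
      ∑ i, fderiv ℝ (momentum T ε e q) x (-(x ∘L B Z)) i * u i =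
        y (B (leafDir B Ti ε e q x Z) (ε s (frameSum e u)))
        - y (fderiv ℝ ε s (frameSum e (fderiv ℝ q x (-(x ∘L B Z)))) (frameSum e u)) := by
    intro Z u
    simp_rw [hq.fderiv_momentum hA hx Z]
    rw [frameSum_apply e u]
    simp only [map_sum, map_smul, smul_eq_mul, ← Finset.sum_sub_distrib]
    refine Finset.sum_congr rfl fun i _ => ?_
    ring
  have hX : Ti s X = DX + ε s (frameSum e uX) := by simp [hDX, leafDir, hs, huX]
  have hY : Ti s Y = DY + ε s (frameSum e uY) := by simp [hDY, leafDir, hs, huY]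
  have h1 : x (B X Y) = y (B (Ti s X) (Ti s Y)) := by
    rw [← hA.Ti_bracket hsΩ]
    simp [hydef, leafPoint, ← hs, hA.T_Ti _ hsΩ]
  -- Both leaf directions lie in `𝔥` because `y = F` there, so isotropy at `F` applies.
  have hiso : y (B DX DY) = 0 := by
    have hm : ∀ Z, leafDir B Ti ε e q x Z ∈ 𝔥 := fun Z =>
      fr.mem_of_orthogonal (hq.pairing_le x hx) hy fun j => hq.bracket_leafDir_frame hA hx Z j
    rw [hy _ (fr.bracket_mem _ (hm X) _ (hm Y)), fr.isotropic _ (hm X) _ (hm Y)]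
  -- The derivatives of `ε` in the two sums combine into the bracket of the two transversal parts.
  have hmc := congrArg y (hA.maurerCartan s hsΩ (frameSum e uX) (frameSum e uY))
  rw [map_sub, map_neg] at hmc
  rw [Finset.sum_sub_distrib, hsum X uY]
  simp_rw [mul_comm (uX _)]
  rw [hsum Y uX, h1, hX, hY]
  simp only [map_add, add_apply, hiso]
  rw [hA.skew (ε s (frameSum e uX)) DY, map_neg]
  linarith

/-- The linear functions on the dual space are affine in the momenta. -/
lemma exists_affine (hq : LeafParameter B T ε Ω F e f c W q) [FiniteDimensional ℝ E]
    (hA : AdjointChart B T Ti ε Ω) (fr : LagrangianFrame B F 𝔥 e f c) (X : E) :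
    ∃ (a : Fin n → (Fin n → ℝ) → ℝ) (a₀ : (Fin n → ℝ) → ℝ),
      (∀ i, ContDiffOn ℝ ∞ (a i) (q '' W)) ∧ ContDiffOn ℝ ∞ a₀ (q '' W) ∧
      ∀ x ∈ W, (∀ v ∈ 𝔥, leafPoint T e q x v = F v) →
        x X = ∑ i, a i (q x) * momentum T ε e q x i + a₀ (q x) := by
  have : CompleteSpace E := FiniteDimensional.complete ℝ E
  -- With this `v`, `Ti X` is the sum of the `ε(s) eᵢ` with coefficients `c v` and of an element of
  -- `𝔥`. The minus sign in the coefficients below undoes the one in `momentum`.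
  set v : (Fin n → ℝ) → E :=
    fun d => Ring.inverse (frameChange ε e c d) (Ti (frameSum e d) X) with hv
  have hqΩ : q '' W ⊆ frameSum e ⁻¹' Ω := by
    rintro _ ⟨x, hx, rfl⟩
    exact hq.mem_chart x hx
  have hvs : ContDiffOn ℝ ∞ v (q '' W) := by
    refine ContDiffOn.clm_apply ?_ ?_
    · rintro _ ⟨x, hx, rfl⟩
      obtain ⟨u, hu⟩ := hq.isUnit x hx
      have h1 := contDiffAt_ringInverse ℝ u (n := ∞)
      rw [hu] at h1
      exact h1.comp_contDiffWithinAt _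
        (((contDiffOn_frameChange hA).mono hqΩ) _ ⟨x, hx, rfl⟩)
    · exact (hA.smooth_Ti.comp (frameSum e).contDiff.contDiffOn hqΩ).clm_apply contDiffOn_const
  refine ⟨fun i d => -c (v d) i, fun d => F (projPol e c (v d)), fun i => ?_, ?_, ?_⟩
  · have := (contDiffOn_pi.1 (c.contDiff.comp_contDiffOn hvs) i).neg
    exact this
  · exact (F ∘L projPol e c).contDiff.comp_contDiffOn hvs
  · intro x hx hy
    have hm := hq.mem_chart x hx
    have h1 : frameChange ε e c (q x) (v (q x)) = Ti (frameSum e (q x)) X := by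
      rw [hv, ← mul_apply_eq_comp, Ring.mul_inverse_cancel _ (hq.isUnit x hx)]
      rfl
    have h2 : x X = leafPoint T e q x (Ti (frameSum e (q x)) X) := by
      rw [leafPoint, ContinuousLinearMap.comp_apply, hA.T_Ti _ hm]
    rw [h2, ← h1]
    simp only [frameChange, add_apply, ContinuousLinearMap.comp_apply, map_add,
      hy _ (fr.projPol_mem _), frameSum_apply e (c _), map_sum, map_smul, smul_eq_mul, momentum,
      neg_mul_neg]

/-- By the Darboux identity, a direction killed by `dq` and `dp` lies in the radical of the Kirillov
form, so the rank is at least `dim E - dim radical = 2n`. -/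
lemma surjective_fderiv (hq : LeafParameter B T ε Ω F e f c W q) [FiniteDimensional ℝ E]
    (hA : AdjointChart B T Ti ε Ω) (fr : LagrangianFrame B F 𝔥 e f c)
    (hdim : 2 * n + Module.finrank ℝ (radical B F) = Module.finrank ℝ E) {a : E} (ha : a ∈ Ω)
    (hx : F ∘L Ti a ∈ W) (hy : ∀ v ∈ 𝔥, leafPoint T e q (F ∘L Ti a) v = F v)
    (w : (Fin n → ℝ) × (Fin n → ℝ)) :
    ∃ X, fderiv ℝ (fun x => (q x, momentum T ε e q x)) (F ∘L Ti a) (-((F ∘L Ti a) ∘L B X)) = w := by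
  set x := F ∘L Ti a with hxdef
  have hqd := hq.differentiableAt hx
  have hpd := ((hq.contDiffOn_momentum hA).contDiffAt (hq.isOpen.mem_nhds hx)).differentiableAt
    (by simp)
  rw [hqd.fderiv_prodMk hpd]
  -- Directions are parametrised by `T a Z`, so that the kernel is compared with the radical at `F`,
  -- not at `x`.
  let J : E →ₗ[ℝ] (E →L[ℝ] ℝ) :=
    -(((ContinuousLinearMap.compL ℝ E E ℝ x) ∘L B ∘L T a : E →L[ℝ] E →L[ℝ] ℝ) :
      E →ₗ[ℝ] E →L[ℝ] ℝ)
  have hJ : ∀ Z, J Z = -(x ∘L B (T a Z)) := fun _ => rfl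
  let Λ : E →ₗ[ℝ] (Fin n → ℝ) × (Fin n → ℝ) :=
    (((fderiv ℝ q x).prod (fderiv ℝ (momentum T ε e q) x) :
      (E →L[ℝ] ℝ) →L[ℝ] (Fin n → ℝ) × (Fin n → ℝ)) :
      (E →L[ℝ] ℝ) →ₗ[ℝ] (Fin n → ℝ) × (Fin n → ℝ)) ∘ₗ J
  have hker : LinearMap.ker Λ ≤ radical B F := by
    intro Z hZ
    rw [mem_radical]
    intro Y
    have h1 : fderiv ℝ q x (-(x ∘L B (T a Z))) = 0 := congrArg Prod.fst (LinearMap.mem_ker.1 hZ)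
    have h2 : fderiv ℝ (momentum T ε e q) x (-(x ∘L B (T a Z))) = 0 :=
      congrArg Prod.snd (LinearMap.mem_ker.1 hZ)
    have h3 := hq.darboux hA fr hx hy (T a Z) (T a Y)
    rw [h1, h2, ← hA.T_bracket a ha, hxdef, ContinuousLinearMap.comp_apply, hA.Ti_T a ha] at h3
    simpa using h3
  have hsurj : Function.Surjective Λ := by
    rw [← LinearMap.range_eq_top]
    apply Submodule.eq_top_of_finrank_eq
    have h1 := Λ.finrank_range_add_finrank_ker
    have h2 := Submodule.finrank_mono hker
    have h3 := (LinearMap.range Λ).finrank_le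
    simp only [Module.finrank_prod, Module.finrank_fintype_fun_eq_card, Fintype.card_fin] at h3 ⊢
    omega
  obtain ⟨Z, hZ⟩ := hsurj w
  exact ⟨T a Z, hZ⟩

end LeafParameter

end

/-- Darboux coordinates in which linear functions are affine in the momenta, near a functional `F`
with a Lagrangian subalgebra `𝔥`. -/
theorem exists_darboux_affine [FiniteDimensional ℝ E] {B : E →L[ℝ] E →L[ℝ] E}
    {T Ti ε : E → E →L[ℝ] E} {Ω : Set E} (hA : AdjointChart B T Ti ε Ω) {F : E →L[ℝ] ℝ}
    {𝔥 : Submodule ℝ E} {n : ℕ}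
    (bracket_mem : ∀ X ∈ 𝔥, ∀ Y ∈ 𝔥, B X Y ∈ 𝔥)
    (isotropic : ∀ X ∈ 𝔥, ∀ Y ∈ 𝔥, F (B X Y) = 0) (stab_le : radical B F ≤ 𝔥)
    (hn : Module.finrank ℝ (E ⧸ 𝔥) = n)
    (hdim : 2 * n + Module.finrank ℝ (radical B F) = Module.finrank ℝ E) :
    ∃ (W : Set (E →L[ℝ] ℝ)) (U : Set E) (q p : (E →L[ℝ] ℝ) → Fin n → ℝ),
      IsOpen W ∧ IsOpen U ∧ 0 ∈ U ∧ U ⊆ Ω ∧ (∀ a ∈ U, F ∘L Ti a ∈ W) ∧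
      ContDiffOn ℝ ∞ (fun x => (q x, p x)) W ∧
      (∀ a ∈ U, ∀ w : (Fin n → ℝ) × (Fin n → ℝ), ∃ X,
        fderiv ℝ (fun x => (q x, p x)) (F ∘L Ti a) (-((F ∘L Ti a) ∘L B X)) = w) ∧
      (∀ a ∈ U, ∀ X Y, (F ∘L Ti a) (B X Y) = ∑ i,
        (fderiv ℝ p (F ∘L Ti a) (-((F ∘L Ti a) ∘L B X)) i
            * fderiv ℝ q (F ∘L Ti a) (-((F ∘L Ti a) ∘L B Y)) i
          - fderiv ℝ q (F ∘L Ti a) (-((F ∘L Ti a) ∘L B X)) i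
            * fderiv ℝ p (F ∘L Ti a) (-((F ∘L Ti a) ∘L B Y)) i)) ∧
      ∀ X, ∃ (a : Fin n → (Fin n → ℝ) → ℝ) (a₀ : (Fin n → ℝ) → ℝ),
        (∀ i, ContDiffOn ℝ ∞ (a i) (q '' W)) ∧ ContDiffOn ℝ ∞ a₀ (q '' W) ∧
        ∀ b ∈ U, (F ∘L Ti b) X = ∑ i, a i (q (F ∘L Ti b)) * p (F ∘L Ti b) i
          + a₀ (q (F ∘L Ti b)) := by
  obtain ⟨e, f, c, fr⟩ := exists_lagrangianFrame hA.skew bracket_mem isotropic stab_le hn hdim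
  obtain ⟨W, q, hq⟩ := exists_leafParameter hA fr
  obtain ⟨U, hU, hU0, hUW⟩ := hq.exists_leafPoint_eq hA fr
  refine ⟨W, U, q, momentum T ε e q, hq.isOpen, hU, hU0, fun a ha => (hUW a ha).1,
    fun a ha => (hUW a ha).2.1, hq.smooth.prodMk (hq.contDiffOn_momentum hA),
    fun a ha => hq.surjective_fderiv hA fr hdim (hUW a ha).1 (hUW a ha).2.1 (hUW a ha).2.2,
    fun a ha => hq.darboux hA fr (hUW a ha).2.1 (hUW a ha).2.2, fun X => ?_⟩
  obtain ⟨a, a₀, ha, ha₀, h⟩ := hq.exists_affine hA fr X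
  exact ⟨a, a₀, ha, ha₀, fun b hb => h _ (hUW b hb).2.1 (hUW b hb).2.2⟩

end

/-! ### The chart of the group at the identity. -/

section

section IdentityChart

variable (E : Type*) [NormedAddCommGroup E]
  (G : Type*) [TopologicalSpace G] [ChartedSpace E G] [Group G]

/-- The domain of the preferred chart at the identity. -/
def idRange : Set G := (chartAt E (1 : G)).source

lemma isOpen_idRange : IsOpen (idRange E G) := (chartAt E (1 : G)).open_source

lemma one_mem_idRange : (1 : G) ∈ idRange E G := mem_chart_source E (1 : G)

variable [NormedSpace ℝ E]

/-- The inverse of the preferred chart at the identity, centred at `0`. -/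
def idChart (a : E) : G :=
  (extChartAt 𝓘(ℝ, E) (1 : G)).symm (extChartAt 𝓘(ℝ, E) (1 : G) 1 + a)

/-- The domain of `idChart`. -/
def idDomain : Set E :=
  {a | extChartAt 𝓘(ℝ, E) (1 : G) 1 + a ∈ (extChartAt 𝓘(ℝ, E) (1 : G)).target}

variable {G} in
/-- The preferred chart at the identity, centred at `0`. -/
def idCoord (g : G) : E :=
  extChartAt 𝓘(ℝ, E) (1 : G) g - extChartAt 𝓘(ℝ, E) (1 : G) 1

lemma isOpen_idDomain : IsOpen (idDomain E G) :=
  (isOpen_extChartAt_target (I := 𝓘(ℝ, E)) (1 : G)).preimage (by fun_prop)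

lemma zero_mem_idDomain : (0 : E) ∈ idDomain E G := by
  simp [idDomain]

@[simp] lemma idChart_zero : idChart E G 0 = 1 := by
  simp [idChart]

@[simp] lemma idCoord_one : idCoord E (1 : G) = 0 := by
  simp [idCoord]

variable {E G}

lemma idChart_mem {a : E} (ha : a ∈ idDomain E G) : idChart E G a ∈ idRange E G := by
  have := (extChartAt 𝓘(ℝ, E) (1 : G)).map_target ha
  rwa [extChartAt_source] at this

lemma idCoord_idChart {a : E} (ha : a ∈ idDomain E G) : idCoord E (idChart E G a) = a := by
  rw [idCoord, idChart, (extChartAt 𝓘(ℝ, E) (1 : G)).right_inv ha]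
  abel

lemma idChart_idCoord {g : G} (hg : g ∈ idRange E G) : idChart E G (idCoord E g) = g := by
  have h : g ∈ (extChartAt 𝓘(ℝ, E) (1 : G)).source := by rwa [extChartAt_source]
  rw [idCoord, idChart, add_sub_cancel, (extChartAt 𝓘(ℝ, E) (1 : G)).left_inv h]

variable {X : Type*} [NormedAddCommGroup X] [NormedSpace ℝ X]

/-- A map near the identity with values in a vector space is differentiated in `idChart`. -/
lemma mfderiv_one_eq_fderiv {f : G → X} (hf : MDifferentiableAt 𝓘(ℝ, E) 𝓘(ℝ, X) f 1) :
    (mfderiv 𝓘(ℝ, E) 𝓘(ℝ, X) f 1 : E →L[ℝ] X) = fderiv ℝ (fun a => f (idChart E G a)) 0 := by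
  have h1 : (mfderiv 𝓘(ℝ, E) 𝓘(ℝ, X) f 1 : E →L[ℝ] X)
      = fderiv ℝ (f ∘ (extChartAt 𝓘(ℝ, E) (1 : G)).symm) (extChartAt 𝓘(ℝ, E) (1 : G) 1) := by
    have key : ∀ D : E →L[ℝ] X, HasFDerivWithinAt (writtenInExtChartAt 𝓘(ℝ, E) 𝓘(ℝ, X) 1 f) D
        (Set.range 𝓘(ℝ, E)) (extChartAt 𝓘(ℝ, E) (1 : G) 1) →
        D = fderiv ℝ (f ∘ (extChartAt 𝓘(ℝ, E) (1 : G)).symm)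
          (extChartAt 𝓘(ℝ, E) (1 : G) 1) := by
      intro D h
      rw [modelWithCornersSelf_coe, Set.range_id, hasFDerivWithinAt_univ] at h
      exact h.fderiv.symm
    exact key _ hf.hasMFDerivAt.2
  rw [h1]
  have h2 := fderiv_comp_add_left (𝕜 := ℝ) (f := f ∘ (extChartAt 𝓘(ℝ, E) (1 : G)).symm)
    (x := (0 : E)) (extChartAt 𝓘(ℝ, E) (1 : G) 1)
  rw [add_zero] at h2
  exact h2.symm

/-- A self-map of the group fixing the identity is differentiated in `idChart`. -/
lemma mfderiv_one_eq_fderiv_idCoord {f : G → G} (hf : MDifferentiableAt 𝓘(ℝ, E) 𝓘(ℝ, E) f 1)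
    (h1 : f 1 = 1) :
    (mfderiv 𝓘(ℝ, E) 𝓘(ℝ, E) f 1 : E →L[ℝ] E)
      = fderiv ℝ (fun a => idCoord E (f (idChart E G a))) 0 := by
  have h2 : (mfderiv 𝓘(ℝ, E) 𝓘(ℝ, E) f 1 : E →L[ℝ] E)
      = fderiv ℝ ((fun g : G => extChartAt 𝓘(ℝ, E) (1 : G) g) ∘ f ∘
        (extChartAt 𝓘(ℝ, E) (1 : G)).symm) (extChartAt 𝓘(ℝ, E) (1 : G) 1) := by
    have key : ∀ D : E →L[ℝ] E, HasFDerivWithinAt (writtenInExtChartAt 𝓘(ℝ, E) 𝓘(ℝ, E) 1 f) D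
        (Set.range 𝓘(ℝ, E)) (extChartAt 𝓘(ℝ, E) (1 : G) 1) →
        D = fderiv ℝ ((fun g : G => extChartAt 𝓘(ℝ, E) (1 : G) g) ∘ f ∘
          (extChartAt 𝓘(ℝ, E) (1 : G)).symm) (extChartAt 𝓘(ℝ, E) (1 : G) 1) := by
      intro D h
      rw [modelWithCornersSelf_coe, Set.range_id, hasFDerivWithinAt_univ, writtenInExtChartAt, h1]
        at h
      exact h.fderiv.symm
    exact key _ hf.hasMFDerivAt.2
  rw [h2]
  have h3 := fderiv_comp_add_left (𝕜 := ℝ) (f := (fun g : G => extChartAt 𝓘(ℝ, E) (1 : G) g) ∘ f ∘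
        (extChartAt 𝓘(ℝ, E) (1 : G)).symm)
    (x := (0 : E)) (extChartAt 𝓘(ℝ, E) (1 : G) 1)
  rw [add_zero] at h3
  rw [← h3]
  exact (fderiv_sub_const _).symm

variable [LieGroup 𝓘(ℝ, E) ∞ G]

lemma isManifold_of_lieGroup : IsManifold 𝓘(ℝ, E) ∞ G :=
  (inferInstance : LieGroup 𝓘(ℝ, E) ∞ G).toContMDiffMul.toIsManifold

lemma contMDiffAt_idChart {a : E} (ha : a ∈ idDomain E G) :
    ContMDiffAt 𝓘(ℝ, E) 𝓘(ℝ, E) ∞ (idChart E G) a := by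
  have := isManifold_of_lieGroup (E := E) (G := G)
  have h1 := ((contMDiffOn_extChartAt_symm (I := 𝓘(ℝ, E)) (n := ∞) (1 : G)) _ ha).contMDiffAt
    ((isOpen_extChartAt_target (I := 𝓘(ℝ, E)) (1 : G)).mem_nhds ha)
  have h2 : ContMDiffAt 𝓘(ℝ, E) 𝓘(ℝ, E) ∞
      (fun b : E => extChartAt 𝓘(ℝ, E) (1 : G) 1 + b) a :=
    (contDiff_const.add contDiff_id).contMDiff.contMDiffAt
  exact ContMDiffAt.comp a h1 h2

lemma contMDiffAt_idCoord {g : G} (hg : g ∈ idRange E G) :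
    ContMDiffAt 𝓘(ℝ, E) 𝓘(ℝ, E) ∞ (idCoord E : G → E) g := by
  have := isManifold_of_lieGroup (E := E) (G := G)
  have h1 := ((contMDiffOn_extChartAt (I := 𝓘(ℝ, E)) (n := ∞) (x := (1 : G))) _ hg).contMDiffAt
    ((isOpen_idRange E G).mem_nhds hg)
  have h2 : ContMDiffAt 𝓘(ℝ, E) 𝓘(ℝ, E) ∞
      (fun b : E => b - extChartAt 𝓘(ℝ, E) (1 : G) 1) (extChartAt 𝓘(ℝ, E) (1 : G) g) :=
    (contDiff_id.sub contDiff_const).contMDiff.contMDiffAt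
  exact ContMDiffAt.comp g h2 h1

lemma contDiffAt_idCoord_comp {s : X → G} {x : X} (hs : ContMDiffAt 𝓘(ℝ, X) 𝓘(ℝ, E) ∞ s x)
    (hx : s x ∈ idRange E G) : ContDiffAt ℝ ∞ (fun z => idCoord E (s z)) x :=
  (ContMDiffAt.comp x (contMDiffAt_idCoord hx) hs).contDiffAt

lemma contMDiffAt_idChart_comp {s : X → E} {x : X} (hs : ContDiffAt ℝ ∞ s x)
    (hx : s x ∈ idDomain E G) : ContMDiffAt 𝓘(ℝ, X) 𝓘(ℝ, E) ∞ (fun z => idChart E G (s z)) x :=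
  ContMDiffAt.comp (g := idChart E G) x (contMDiffAt_idChart hx) hs.contMDiffAt

end IdentityChart

/-! ### Adjoint operators and their smooth dependence on the group element. -/

section AdjointOperator

variable {E : Type*} [NormedAddCommGroup E] [NormedSpace ℝ E]
  {G : Type*} [TopologicalSpace G] [ChartedSpace E G] [Group G]

/-- The adjoint operator of `g`, as a continuous linear map of the model space. -/
def AdL (g : G) : E →L[ℝ] E :=
  (mfderiv 𝓘(ℝ, E) 𝓘(ℝ, E) (fun x : G => g * x * g⁻¹) 1 : LieAlg E G →L[ℝ] LieAlg E G)

variable [LieGroup 𝓘(ℝ, E) ∞ G]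

lemma contMDiff_conj (g : G) :
    ContMDiff 𝓘(ℝ, E) 𝓘(ℝ, E) ∞ (fun x : G => g * x * g⁻¹) :=
  (contMDiff_const.mul contMDiff_id).mul contMDiff_const

lemma AdL_eq_fderiv (g : G) :
    AdL (E := E) g = fderiv ℝ (fun a => idCoord E (g * idChart E G a * g⁻¹)) 0 :=
  mfderiv_one_eq_fderiv_idCoord ((contMDiff_conj g).mdifferentiable (by simp) 1) (by simp)

lemma hasFDerivAt_conj (g : G) :
    HasFDerivAt (fun a => idCoord E (g * idChart E G a * g⁻¹)) (AdL (E := E) g) 0 := by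
  rw [AdL_eq_fderiv]
  refine DifferentiableAt.hasFDerivAt (ContDiffAt.differentiableAt (n := ∞) ?_ (by simp))
  refine contDiffAt_idCoord_comp ?_ ?_
  · exact ContMDiffAt.comp (0 : E) (contMDiff_conj g).contMDiffAt
      (contMDiffAt_idChart (zero_mem_idDomain E G))
  · simpa using one_mem_idRange E G

lemma AdL_one : AdL (E := E) (1 : G) = ContinuousLinearMap.id ℝ E := by
  refine (hasFDerivAt_conj (1 : G)).unique
    ((hasFDerivAt_id (𝕜 := ℝ) (0 : E)).congr_of_eventuallyEq ?_)
  filter_upwards [(isOpen_idDomain E G).mem_nhds (zero_mem_idDomain E G)] with a ha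
  simp [idCoord_idChart ha]

lemma AdL_mul (g h : G) : AdL (E := E) (g * h) = AdL g ∘L AdL h := by
  have h0 : idCoord E (h * idChart E G 0 * h⁻¹) = 0 := by simp
  have h1 : HasFDerivAt (fun a => idCoord E (g * idChart E G a * g⁻¹)) (AdL (E := E) g)
    (idCoord E (h * idChart E G 0 * h⁻¹)) := by rw [h0]; exact hasFDerivAt_conj g
  refine (hasFDerivAt_conj (g * h)).unique
    ((h1.comp (0 : E) (hasFDerivAt_conj h)).congr_of_eventuallyEq ?_)
  have hc : ContinuousAt (fun a => h * idChart E G a * h⁻¹) (0 : E) :=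
    (ContMDiffAt.comp (0 : E) (contMDiff_conj h).contMDiffAt
      (contMDiffAt_idChart (zero_mem_idDomain E G))).continuousAt
  filter_upwards [hc.eventually_mem ((isOpen_idRange E G).mem_nhds
    (by simpa using one_mem_idRange E G))] with a ha
  simp only [Function.comp_apply, idChart_idCoord ha]
  congr 1
  group

lemma AdL_inv_apply (g : G) (v : E) : AdL g⁻¹ (AdL g v) = v := by
  have := AdL_mul (E := E) g⁻¹ g
  rw [inv_mul_cancel, AdL_one] at this
  exact (congrArg (fun L : E →L[ℝ] E => L v) this).symm

lemma AdL_apply_inv (g : G) (v : E) : AdL g (AdL g⁻¹ v) = v := by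
  have := AdL_inv_apply (E := E) g⁻¹ v
  rwa [inv_inv] at this

/-- Conjugation in the chart is jointly smooth in the parameter and the argument, so its partial
derivative at `0` is smooth in the parameter. -/
lemma contDiffAt_AdL {X : Type*} [NormedAddCommGroup X] [NormedSpace ℝ X] {s : X → G} {x : X}
    (hs : ContMDiffAt 𝓘(ℝ, X) 𝓘(ℝ, E) ∞ s x) : ContDiffAt ℝ ∞ (fun z => AdL (E := E) (s z)) x := by
  have h1 : ContMDiffAt 𝓘(ℝ, X × E) 𝓘(ℝ, E) ∞ (fun z : X × E => s z.1) (x, 0) :=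
    ContMDiffAt.comp (x, (0 : E)) hs contDiff_fst.contMDiff.contMDiffAt
  have h2 : ContMDiffAt 𝓘(ℝ, X × E) 𝓘(ℝ, E) ∞ (fun z : X × E => idChart E G z.2) (x, 0) :=
    contMDiffAt_idChart_comp contDiff_snd.contDiffAt (zero_mem_idDomain E G)
  have h3 : ContDiffAt ℝ ∞ (Function.uncurry fun z a =>
      idCoord E (s z * idChart E G a * (s z)⁻¹)) (x, (0 : E)) := by
    refine contDiffAt_idCoord_comp (s := fun z : X × E => s z.1 * idChart E G z.2 * (s z.1)⁻¹)
      ((h1.mul h2).mul h1.inv) ?_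
    simpa using one_mem_idRange E G
  have h4 := ContDiffAt.fderiv (g := fun _ => (0 : E)) (m := ∞) h3 contDiffAt_const (by simp)
  simpa only [← AdL_eq_fderiv] using h4

end AdjointOperator

end

/-! ### Group law and bracket in the chart; the differential of `Ad`. -/

section

variable {E : Type*} [NormedAddCommGroup E] [NormedSpace ℝ E]
  {G : Type*} [TopologicalSpace G] [ChartedSpace E G] [Group G]

variable (E G) in
/-- The group law in `idChart`. -/
def chartMul (z : E × E) : E :=
  idCoord E (idChart E G z.1 * idChart E G z.2)

variable (E G) in
/-- The left-invariant vector fields in `idChart`. -/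
def chartLeft (a : E) : E →L[ℝ] E :=
  fderiv ℝ (fun b => chartMul E G (a, b)) 0

variable (E G) in
/-- The bracket of the Lie algebra, as a continuous bilinear map of the model space. -/
def chartBracket : E →L[ℝ] E →L[ℝ] E :=
  fderiv ℝ (chartLeft E G) 0 - (fderiv ℝ (chartLeft E G) 0).flip

lemma chartMul_right_zero {a : E} (ha : a ∈ idDomain E G) : chartMul E G (a, 0) = a := by
  simp [chartMul, idCoord_idChart ha]

lemma chartMul_left_zero {a : E} (ha : a ∈ idDomain E G) : chartMul E G (0, a) = a := by
  simp [chartMul, idCoord_idChart ha]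

lemma chartLeft_zero : chartLeft E G 0 = ContinuousLinearMap.id ℝ E := by
  have h := (hasFDerivAt_id (𝕜 := ℝ) (0 : E)).congr_of_eventuallyEq
    (f₁ := fun b => chartMul E G (0, b)) (by
      filter_upwards [(isOpen_idDomain E G).mem_nhds (zero_mem_idDomain E G)] with a ha
      exact chartMul_left_zero ha)
  exact h.fderiv

variable [LieGroup 𝓘(ℝ, E) ∞ G]

lemma contMDiffAt_chart_mul {a b : E} (ha : a ∈ idDomain E G) (hb : b ∈ idDomain E G) :
    ContMDiffAt 𝓘(ℝ, E × E) 𝓘(ℝ, E) ∞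
      (fun z : E × E => idChart E G z.1 * idChart E G z.2) (a, b) :=
  (contMDiffAt_idChart_comp contDiff_fst.contDiffAt ha).mul
    (contMDiffAt_idChart_comp contDiff_snd.contDiffAt hb)

lemma contDiffAt_chartMul {a b : E} (ha : a ∈ idDomain E G) (hb : b ∈ idDomain E G)
    (h : idChart E G a * idChart E G b ∈ idRange E G) :
    ContDiffAt ℝ ∞ (chartMul E G) (a, b) :=
  contDiffAt_idCoord_comp (contMDiffAt_chart_mul ha hb) h

lemma contDiffAt_chartMul_zero {a : E} (ha : a ∈ idDomain E G) :
    ContDiffAt ℝ ∞ (chartMul E G) (a, 0) :=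
  contDiffAt_chartMul ha (zero_mem_idDomain E G) (by simpa using idChart_mem ha)

lemma contDiffAt_zero_chartMul {a : E} (ha : a ∈ idDomain E G) :
    ContDiffAt ℝ ∞ (chartMul E G) (0, a) :=
  contDiffAt_chartMul (zero_mem_idDomain E G) ha (by simpa using idChart_mem ha)

lemma hasFDerivAt_chartLeft {a : E} (ha : a ∈ idDomain E G) :
    HasFDerivAt (fun b => chartMul E G (a, b)) (chartLeft E G a) 0 := by
  have h := ((contDiffAt_chartMul_zero ha).differentiableAt (by simp)).hasFDerivAt.comp (0 : E)
    (hasFDerivAt_prodMk_right a 0)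
  exact h.differentiableAt.hasFDerivAt

lemma chartLeft_apply {a : E} (ha : a ∈ idDomain E G) (Y : E) :
    chartLeft E G a Y = fderiv ℝ (chartMul E G) (a, 0) (0, Y) := by
  have h := ((contDiffAt_chartMul_zero ha).differentiableAt (by simp)).hasFDerivAt.comp (0 : E)
    (hasFDerivAt_prodMk_right a 0)
  rw [(hasFDerivAt_chartLeft ha).unique h]
  simp

lemma contDiffOn_chartLeft : ContDiffOn ℝ ∞ (chartLeft E G) (idDomain E G) := by
  intro a ha
  have h := ContDiffAt.fderiv (f := fun a b => chartMul E G (a, b)) (g := fun _ => (0 : E))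
    (m := ∞) (n := ∞) (x₀ := a) (contDiffAt_chartMul_zero ha) contDiffAt_const (by simp)
  exact h.contDiffWithinAt

lemma differentiableAt_chartLeft {a : E} (ha : a ∈ idDomain E G) :
    DifferentiableAt ℝ (chartLeft E G) a :=
  (contDiffOn_chartLeft.contDiffAt ((isOpen_idDomain E G).mem_nhds ha)).differentiableAt (by simp)

lemma AdL_chart_mul {a b : E} (h : idChart E G a * idChart E G b ∈ idRange E G) :
    AdL (E := E) (idChart E G (chartMul E G (a, b)))
      = AdL (idChart E G a) ∘L AdL (idChart E G b) := by
  rw [chartMul, idChart_idCoord h, AdL_mul]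

lemma contDiffOn_AdL : ContDiffOn ℝ ∞ (fun a => AdL (E := E) (idChart E G a)) (idDomain E G) :=
  fun _ ha => (contDiffAt_AdL (contMDiffAt_idChart ha)).contDiffWithinAt

lemma contDiffOn_AdL_inv :
    ContDiffOn ℝ ∞ (fun a => AdL (E := E) (idChart E G a)⁻¹) (idDomain E G) :=
  fun _ ha => (contDiffAt_AdL (contMDiffAt_idChart ha).inv).contDiffWithinAt

lemma differentiableAt_AdL {a : E} (ha : a ∈ idDomain E G) :
    DifferentiableAt ℝ (fun a => AdL (E := E) (idChart E G a)) a :=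
  (contDiffOn_AdL.contDiffAt ((isOpen_idDomain E G).mem_nhds ha)).differentiableAt (by simp)

/-- The differential of the adjoint representation is the bracket. -/
lemma fderiv_AdL_zero (X Y : E) :
    fderiv ℝ (fun a => AdL (E := E) (idChart E G a)) 0 X Y = chartBracket E G X Y := by
  have hz := zero_mem_idDomain E G
  have hnz := (isOpen_idDomain E G).mem_nhds hz
  set μ := chartMul E G with hμ
  set D := fderiv ℝ (fderiv ℝ μ) (0, 0) with hD
  have hμ0 : ContDiffAt ℝ ∞ μ (0, 0) := contDiffAt_chartMul_zero hz
  have hDμ : HasFDerivAt (fderiv ℝ μ) D (0, 0) :=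
    ((hμ0.fderiv_right (m := ∞) (by simp)).differentiableAt (by simp)).hasFDerivAt
  have hsymm : ∀ v w, D v w = D w v := fun v w =>
    hμ0.isSymmSndFDerivAt (by
      rw [minSmoothness_of_isRCLikeNormedField]; exact WithTop.coe_le_coe.2 le_top) v w
  have hleft : ∀ X Y, fderiv ℝ (chartLeft E G) 0 X Y = D (X, 0) (0, Y) := by
    intro X Y
    have h1 : HasFDerivAt (fun a => fderiv ℝ μ (a, 0) (0, Y))
        ((D ∘L ContinuousLinearMap.inl ℝ E E).flip (0, Y)) 0 := by
      have := (HasFDerivAt.comp (f := fun a : E => (a, (0 : E))) (0 : E) hDμ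
        (hasFDerivAt_prodMk_left (0 : E) (0 : E))).clm_apply
        (hasFDerivAt_const ((0 : E), Y) (0 : E))
      simpa using this
    have h2 : HasFDerivAt (fun a => chartLeft E G a Y)
        ((D ∘L ContinuousLinearMap.inl ℝ E E).flip (0, Y)) 0 := by
      refine h1.congr_of_eventuallyEq ?_
      filter_upwards [hnz] with a ha
      exact chartLeft_apply ha Y
    have h3 := (differentiableAt_chartLeft hz).hasFDerivAt.clm_apply (hasFDerivAt_const Y (0 : E))
    have h4 := congrArg (fun L : E →L[ℝ] E => L X) (h3.unique h2)
    simpa using h4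
  set ρ : E → E →L[ℝ] E := fun a => fderiv ℝ μ (0, a) ∘L ContinuousLinearMap.inl ℝ E E with hρ
  have hρ' : HasFDerivAt ρ (((ContinuousLinearMap.compL ℝ E (E × E) E).flip
      (ContinuousLinearMap.inl ℝ E E)) ∘L (D ∘L ContinuousLinearMap.inr ℝ E E)) 0 :=
    (((ContinuousLinearMap.compL ℝ E (E × E) E).flip
      (ContinuousLinearMap.inl ℝ E E)).hasFDerivAt).comp (0 : E)
      (HasFDerivAt.comp (0 : E) hDμ (hasFDerivAt_prodMk_right (0 : E) (0 : E)))
  have hρa : ∀ a ∈ idDomain E G, HasFDerivAt (fun b => μ (b, a)) (ρ a) 0 := fun a ha =>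
    HasFDerivAt.comp (f := fun b : E => (b, a)) (0 : E)
      ((contDiffAt_zero_chartMul ha).differentiableAt (by simp)).hasFDerivAt
      (hasFDerivAt_prodMk_left (0 : E) a)
  have hρ0 : ρ 0 = ContinuousLinearMap.id ℝ E := by
    refine (hρa 0 hz).unique ((hasFDerivAt_id (𝕜 := ℝ) (0 : E)).congr_of_eventuallyEq ?_)
    filter_upwards [hnz] with a ha
    exact chartMul_right_zero ha
  -- This is `ab = (aba⁻¹)a`. Differentiated at `0`, it expresses `d Ad` as the derivative of
  -- `chartLeft` minus that of `ρ`; symmetry of second derivatives makes the latter the flip of the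
  -- former.
  have hfact : ∀ a ∈ idDomain E G, chartLeft E G a = ρ a ∘L AdL (idChart E G a) := by
    intro a ha
    have h0 : idCoord E (idChart E G a * idChart E G 0 * (idChart E G a)⁻¹) = 0 := by simp
    have h1 : HasFDerivAt (fun b => μ (b, a)) (ρ a)
        (idCoord E (idChart E G a * idChart E G 0 * (idChart E G a)⁻¹)) := by
      rw [h0]; exact hρa a ha
    refine (hasFDerivAt_chartLeft ha).unique
      ((h1.comp (0 : E) (hasFDerivAt_conj (idChart E G a))).congr_of_eventuallyEq ?_)
    have hc : ContinuousAt
        (fun b => idChart E G a * idChart E G b * (idChart E G a)⁻¹) (0 : E) :=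
      (ContMDiffAt.comp (0 : E) (contMDiff_conj (idChart E G a)).contMDiffAt
        (contMDiffAt_idChart (zero_mem_idDomain E G))).continuousAt
    filter_upwards [hc.eventually_mem ((isOpen_idRange E G).mem_nhds
      (by simpa using one_mem_idRange E G))] with b hb
    simp only [hμ, Function.comp_apply, chartMul, idChart_idCoord hb]
    congr 1
    group
  have hprod := hρ'.clm_comp (differentiableAt_AdL hz).hasFDerivAt
  have hleft' : HasFDerivAt (chartLeft E G) _ 0 :=
    hprod.congr_of_eventuallyEq (by filter_upwards [hnz] with a ha; exact hfact a ha)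
  have h5 := congrArg (fun L : E →L[ℝ] E →L[ℝ] E => L X Y) hleft'.fderiv
  simp only [add_apply, ContinuousLinearMap.comp_apply, ContinuousLinearMap.compL_apply,
    ContinuousLinearMap.flip_apply, hρ0, idChart_zero, AdL_one, ContinuousLinearMap.id_apply,
    ContinuousLinearMap.inl_apply, ContinuousLinearMap.inr_apply] at h5
  rw [chartBracket, sub_apply, sub_apply, ContinuousLinearMap.flip_apply, h5, hleft Y X,
    hsymm (Y, 0) (0, X)]
  abel

/-- Differentiate `Ad(ab) = Ad(a) Ad(b)` in `b` at the identity. -/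
lemma fderiv_AdL_chartLeft {a : E} (ha : a ∈ idDomain E G) (X Y : E) :
    fderiv ℝ (fun a => AdL (E := E) (idChart E G a)) a (chartLeft E G a X) Y
      = AdL (idChart E G a) (chartBracket E G X Y) := by
  have hz := zero_mem_idDomain E G
  have h0 : HasFDerivAt (fun a => AdL (E := E) (idChart E G a))
      (fderiv ℝ (fun a => AdL (E := E) (idChart E G a)) a) (chartMul E G (a, 0)) := by
    rw [chartMul_right_zero ha]; exact (differentiableAt_AdL ha).hasFDerivAt
  have h1 := (h0.comp (0 : E) (hasFDerivAt_chartLeft ha)).clm_apply (hasFDerivAt_const Y (0 : E))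
  have h2 := (AdL (E := E) (idChart E G a)).hasFDerivAt.comp (0 : E)
    ((differentiableAt_AdL hz).hasFDerivAt.clm_apply (hasFDerivAt_const Y (0 : E)))
  have hc : ContinuousAt (fun b => idChart E G a * idChart E G b) (0 : E) :=
    (ContMDiffAt.mul (I := 𝓘(ℝ, E)) (n := ∞) contMDiffAt_const
      (contMDiffAt_idChart (zero_mem_idDomain E G))).continuousAt
  have h3 := h2.congr_of_eventuallyEq
    (f₁ := fun b => AdL (E := E) (idChart E G (chartMul E G (a, b))) Y) (by
    filter_upwards [hc.eventually_mem ((isOpen_idRange E G).mem_nhds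
      (by simpa using idChart_mem ha))] with b hb
    simp [AdL_chart_mul hb])
  have h4 := congrArg (fun L : E →L[ℝ] E => L X) (h1.unique h3)
  simpa [fderiv_AdL_zero] using h4

/-- Differentiate `Ad(gbg⁻¹) Ad(g) = Ad(g) Ad(b)` in `b` at the identity. -/
lemma chartBracket_AdL (g : G) (X Y : E) :
    AdL g (chartBracket E G X Y) = chartBracket E G (AdL g X) (AdL g Y) := by
  have hz := zero_mem_idDomain E G
  have h0 : HasFDerivAt (fun a => AdL (E := E) (idChart E G a))
      (fderiv ℝ (fun a => AdL (E := E) (idChart E G a)) 0)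
      (idCoord E (g * idChart E G 0 * g⁻¹)) := by
    simpa using (differentiableAt_AdL hz).hasFDerivAt
  have h1 := (h0.comp (0 : E) (hasFDerivAt_conj g)).clm_apply
    (hasFDerivAt_const (AdL g Y) (0 : E))
  have h2 := (AdL (E := E) g).hasFDerivAt.comp (0 : E)
    ((differentiableAt_AdL hz).hasFDerivAt.clm_apply (hasFDerivAt_const Y (0 : E)))
  have hc : ContinuousAt (fun a => g * idChart E G a * g⁻¹) (0 : E) :=
    (ContMDiffAt.comp (0 : E) (contMDiff_conj g).contMDiffAt
      (contMDiffAt_idChart (zero_mem_idDomain E G))).continuousAt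
  have h3 := h2.congr_of_eventuallyEq
    (f₁ := fun b => AdL (E := E) (idChart E G (idCoord E (g * idChart E G b * g⁻¹))) (AdL g Y)) (by
    filter_upwards [hc.eventually_mem ((isOpen_idRange E G).mem_nhds
      (by simpa using one_mem_idRange E G))] with b hb
    simp [idChart_idCoord hb, AdL_mul, AdL_inv_apply])
  have h4 := congrArg (fun L : E →L[ℝ] E => L X) (h1.unique h3)
  simpa [fderiv_AdL_zero] using h4.symm

end

/-! ### Left-invariant fields and the Maurer-Cartan equation. -/

section

variable {E : Type*} [NormedAddCommGroup E] [NormedSpace ℝ E]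
  {G : Type*} [TopologicalSpace G] [ChartedSpace E G] [Group G]
  [LieGroup 𝓘(ℝ, E) ∞ G]

open VectorField in
/-- `chartLeft` represents the left-invariant vector fields in `idChart`. -/
lemma mpullback_mulInvariantVectorField_idChart {a : E} (ha : a ∈ idDomain E G)
    (X : LieAlg E G) :
    (mpullback 𝓘(ℝ, E) 𝓘(ℝ, E) (idChart E G) (mulInvariantVectorField X) a : E)
      = chartLeft E G a X := by
  have hτ : MDifferentiableAt 𝓘(ℝ, E) 𝓘(ℝ, E) (idChart E G) a :=
    (contMDiffAt_idChart ha).mdifferentiableAt (by simp)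
  have hκ : MDifferentiableAt 𝓘(ℝ, E) 𝓘(ℝ, E) (idCoord E : G → E) (idChart E G a) :=
    (contMDiffAt_idCoord (idChart_mem ha)).mdifferentiableAt (by simp)
  have h1 : mfderiv 𝓘(ℝ, E) 𝓘(ℝ, E) (idCoord E : G → E) (idChart E G a) ∘L
      mfderiv 𝓘(ℝ, E) 𝓘(ℝ, E) (idChart E G) a = ContinuousLinearMap.id ℝ E := by
    rw [← mfderiv_comp a hκ hτ]
    have : (idCoord E : G → E) ∘ idChart E G =ᶠ[nhds a] id := by
      filter_upwards [(isOpen_idDomain E G).mem_nhds ha] with b hb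
      exact idCoord_idChart hb
    rw [this.mfderiv_eq, mfderiv_id]
    rfl
  have h2 : mfderiv 𝓘(ℝ, E) 𝓘(ℝ, E) (idChart E G) a ∘L
      mfderiv 𝓘(ℝ, E) 𝓘(ℝ, E) (idCoord E : G → E) (idChart E G a)
        = ContinuousLinearMap.id ℝ (TangentSpace 𝓘(ℝ, E) (idChart E G a)) := by
    have hc := mfderiv_comp_of_eq (x := idChart E G a) (g := idChart E G)
      (f := (idCoord E : G → E)) hτ hκ (idCoord_idChart ha)
    have : idChart E G ∘ (idCoord E : G → E) =ᶠ[nhds (idChart E G a)] id := by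
      filter_upwards [(isOpen_idRange E G).mem_nhds (idChart_mem ha)] with b hb
      exact idChart_idCoord hb
    rw [this.mfderiv_eq, mfderiv_id] at hc
    let τ' : E → E →L[ℝ] E := fun b => mfderiv 𝓘(ℝ, E) 𝓘(ℝ, E) (idChart E G) b
    -- The chain rule has base point `idCoord (idChart a)`, equal to `a` only propositionally;
    -- tangent spaces are read as `E` to rewrite along this equality.
    have key : ∀ b, b = a → ∀ D : E →L[ℝ] E, τ' b ∘L D = ContinuousLinearMap.id ℝ E →
        τ' a ∘L D = ContinuousLinearMap.id ℝ E := by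
      rintro b rfl D h
      exact h
    exact key _ (idCoord_idChart ha) _ hc.symm
  have h3 : (mfderiv 𝓘(ℝ, E) 𝓘(ℝ, E) (idChart E G) a).inverse
      = mfderiv 𝓘(ℝ, E) 𝓘(ℝ, E) (idCoord E : G → E) (idChart E G a) :=
    ContinuousLinearMap.inverse_eq h2 h1
  have hL : MDifferentiableAt 𝓘(ℝ, E) 𝓘(ℝ, E) (fun g : G => idChart E G a * g) 1 :=
    (contMDiff_mul_left (I := 𝓘(ℝ, E)) (n := ∞)).mdifferentiable (by simp) 1
  have h4 := mfderiv_comp_of_eq (x := (1 : G)) (g := (idCoord E : G → E))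
      (f := fun g : G => idChart E G a * g) hκ hL (mul_one _)
  have h5 : MDifferentiableAt 𝓘(ℝ, E) 𝓘(ℝ, E)
      ((idCoord E : G → E) ∘ fun g : G => idChart E G a * g) 1 := by
    refine MDifferentiableAt.comp (1 : G) ?_ hL
    simpa only [mul_one] using hκ
  have h6 := mfderiv_one_eq_fderiv h5
  rw [mpullback_apply, h3]
  have h7 := congrArg (fun D : E →L[ℝ] E => D X) (h4.symm.trans h6)
  have key : ∀ g : G, g = idChart E G a → ∀ w : E,
      (mfderiv 𝓘(ℝ, E) 𝓘(ℝ, E) (idCoord E : G → E) g : E →L[ℝ] E) w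
        = (mfderiv 𝓘(ℝ, E) 𝓘(ℝ, E) (idCoord E : G → E) (idChart E G a) : E →L[ℝ] E) w := by
    rintro g rfl w
    rfl
  exact (key _ (mul_one _) _).symm.trans h7

-- Left-invariant fields are closed under the bracket, and pullback by the chart commutes with Lie
-- brackets.
open VectorField in
lemma chartLeft_lie [FiniteDimensional ℝ E] {a : E} (ha : a ∈ idDomain E G) (X Y : LieAlg E G) :
    fderiv ℝ (chartLeft E G) a (chartLeft E G a X) Y
      - fderiv ℝ (chartLeft E G) a (chartLeft E G a Y) X
          = chartLeft E G a (⁅X, Y⁆ : LieAlg E G) := by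
  have hb : ∀ Z : LieAlg E G, mpullback 𝓘(ℝ, E) 𝓘(ℝ, E) (idChart E G) (mulInvariantVectorField Z)
      =ᶠ[nhds a] fun b => chartLeft E G b Z := fun Z => by
    filter_upwards [(isOpen_idDomain E G).mem_nhds ha] with b hb
    exact mpullback_mulInvariantVectorField_idChart hb Z
  have h1 := mpullback_mlieBracket (n := ∞) (I := 𝓘(ℝ, E)) (I' := 𝓘(ℝ, E))
    (mdifferentiableAt_mulInvariantVectorField (I := 𝓘(ℝ, E)) X (g := idChart E G a))
    (mdifferentiableAt_mulInvariantVectorField (I := 𝓘(ℝ, E)) Y (g := idChart E G a))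
    (contMDiffAt_idChart ha)
    (by rw [minSmoothness_of_isRCLikeNormedField]; exact WithTop.coe_le_coe.2 le_top)
  rw [← mulInvariantVector_mlieBracket, (hb X).mlieBracket_vectorField_eq (hb Y)] at h1
  have h0 : ∀ V W : (b : E) → TangentSpace 𝓘(ℝ, E) b,
      mlieBracket 𝓘(ℝ, E) V W a = lieBracket ℝ (V : E → E) (W : E → E) a := fun V W => by
    rw [← mlieBracketWithin_univ, mlieBracketWithin_eq_lieBracketWithin]
    exact congrFun lieBracketWithin_univ a
  have h2 := mpullback_mulInvariantVectorField_idChart ha ⁅X, Y⁆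
  have hd : ∀ Z : E, HasFDerivAt (fun b => chartLeft E G b Z)
      ((fderiv ℝ (chartLeft E G) a).flip Z) a := fun Z => by
    simpa using (differentiableAt_chartLeft ha).hasFDerivAt.clm_apply (hasFDerivAt_const Z a)
  have h3 : lieBracket ℝ (fun b => chartLeft E G b X) (fun b => chartLeft E G b Y) a
      = fderiv ℝ (chartLeft E G) a (chartLeft E G a X) Y
      - fderiv ℝ (chartLeft E G) a (chartLeft E G a Y) X := by
    rw [lieBracket, (hd X).fderiv, (hd Y).fderiv]
    rfl
  exact h3.symm.trans ((h0 _ _).symm.trans (h1.symm.trans h2))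

/-- The bracket of the Lie algebra is `chartBracket`. -/
lemma lie_eq_chartBracket [FiniteDimensional ℝ E] (X Y : LieAlg E G) :
    (⁅X, Y⁆ : LieAlg E G) = chartBracket E G X Y := by
  have h := chartLeft_lie (zero_mem_idDomain E G) X Y
  rw [chartLeft_zero] at h
  exact h.symm

variable (E G) in
/-- The part of the domain of `idChart` where the left-invariant fields are a frame. -/
def adjointDomain : Set E := {a | a ∈ idDomain E G ∧ IsUnit (chartLeft E G a)}

variable (E G) in
/-- The adjoint representation of a Lie group in the chart at the identity. -/
theorem adjointChart [FiniteDimensional ℝ E] :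
    AdjointChart (chartBracket E G) (fun a => AdL (idChart E G a))
      (fun a => AdL (idChart E G a)⁻¹) (fun a => Ring.inverse (chartLeft E G a))
      (adjointDomain E G) := by
  have : CompleteSpace E := FiniteDimensional.complete ℝ E
  have hεA : ∀ a ∈ adjointDomain E G, ∀ v,
      Ring.inverse (chartLeft E G a) (chartLeft E G a v) = v := fun a ha v => by
    rw [← mul_apply_eq_comp, Ring.inverse_mul_cancel _ ha.2]; rfl
  have hAε : ∀ a ∈ adjointDomain E G, ∀ v,
      chartLeft E G a (Ring.inverse (chartLeft E G a) v) = v := fun a ha v => by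
    rw [← mul_apply_eq_comp, Ring.mul_inverse_cancel _ ha.2]; rfl
  have hopen : IsOpen (adjointDomain E G) :=
    (contDiffOn_chartLeft (E := E) (G := G)).continuousOn.isOpen_inter_preimage
      (isOpen_idDomain E G) Units.isOpen
  have hε : ContDiffOn ℝ ∞ (fun a => Ring.inverse (chartLeft E G a)) (adjointDomain E G) := by
    intro a ha
    obtain ⟨u, hu⟩ := ha.2
    have h1 := contDiffAt_ringInverse ℝ u (n := ∞)
    rw [hu] at h1
    exact h1.comp_contDiffWithinAt a
      ((contDiffOn_chartLeft a ha.1).mono fun _ h => h.1)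
  refine ⟨hopen, ⟨zero_mem_idDomain E G, ?_⟩, fun X Y => ?_, contDiffOn_AdL.mono fun _ h => h.1,
    contDiffOn_AdL_inv.mono fun _ h => h.1, hε, fun v => ?_, fun v => ?_,
    fun a _ v => AdL_apply_inv _ v, fun a _ v => AdL_inv_apply _ v,
    fun a _ X Y => chartBracket_AdL _ X Y, fun a ha v w => ?_, fun a ha v w => ?_⟩
  · rw [chartLeft_zero]
    exact isUnit_one
  · simp [chartBracket]
  · simp [AdL_one]
  · have h0 : Ring.inverse (chartLeft E G 0) = 1 := by
      rw [chartLeft_zero]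
      exact Ring.inverse_one _
    rw [h0]
    rfl
  · conv_lhs => rw [← hAε a ha v]
    exact fderiv_AdL_chartLeft ha.1 _ _
  · have hεd : DifferentiableAt ℝ (fun a => Ring.inverse (chartLeft E G a)) a :=
      (hε.contDiffAt (hopen.mem_nhds ha)).differentiableAt (by simp)
    set ε := fun a => Ring.inverse (chartLeft E G a) with hεdef
    -- Differentiating `chartLeft ∘ ε = 1` turns the bracket relation of the invariant frame into
    -- the Maurer-Cartan equation for its inverse `ε`.
    have hderiv : ∀ v w, fderiv ℝ (chartLeft E G) a v (ε a w)
        = -chartLeft E G a (fderiv ℝ ε a v w) := by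
      intro v w
      have h1 := (differentiableAt_chartLeft ha.1).hasFDerivAt.clm_comp hεd.hasFDerivAt
      have h2 : HasFDerivAt (fun b => chartLeft E G b ∘L ε b) (0 : E →L[ℝ] E →L[ℝ] E) a := by
        refine (hasFDerivAt_const (ContinuousLinearMap.id ℝ E) a).congr_of_eventuallyEq ?_
        filter_upwards [hopen.mem_nhds ha] with b hb
        ext w
        exact hAε b hb w
      have h3 := congrArg (fun L : E →L[ℝ] E →L[ℝ] E => L v w) (h1.unique h2)
      simp only [add_apply, ContinuousLinearMap.comp_apply, ContinuousLinearMap.compL_apply,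
        ContinuousLinearMap.flip_apply, zero_apply] at h3
      exact eq_neg_of_add_eq_zero_right h3
    have h4 := (chartLeft_lie ha.1 (ε a v) (ε a w)).trans
      (congrArg (chartLeft E G a) (lie_eq_chartBracket (ε a v) (ε a w)))
    rw [hAε a ha, hAε a ha, hderiv, hderiv] at h4
    have h5 := congrArg (ε a) h4
    rw [map_sub, map_neg, map_neg, hεA a ha, hεA a ha, hεA a ha] at h5
    rw [← h5]
    abel

end

/-! ### Transport of Lagrangian subalgebras; the coadjoint action as a smooth map. -/

section

section Transport

variable {E : Type*} [NormedAddCommGroup E] [NormedSpace ℝ E]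

/-- A Lagrangian subalgebra containing the radical of the Kirillov form at `F`. -/
structure IsLagrangian (B : E →L[ℝ] E →L[ℝ] E) (F : E →L[ℝ] ℝ) (𝔥 : Submodule ℝ E) (n : ℕ) :
    Prop where
  bracket_mem : ∀ X ∈ 𝔥, ∀ Y ∈ 𝔥, B X Y ∈ 𝔥
  isotropic : ∀ X ∈ 𝔥, ∀ Y ∈ 𝔥, F (B X Y) = 0
  radical_le : radical B F ≤ 𝔥
  finrank_quotient : Module.finrank ℝ (E ⧸ 𝔥) = n
  finrank_radical : 2 * n + Module.finrank ℝ (radical B F) = Module.finrank ℝ E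

/-- Every condition is invariant under automorphisms of the bracket. With `Φ = Ad(g₀)` this moves
the polarization from `F` to `K(g₀)F`. -/
lemma IsLagrangian.map [FiniteDimensional ℝ E] {B : E →L[ℝ] E →L[ℝ] E} {F : E →L[ℝ] ℝ}
    {𝔥 : Submodule ℝ E} {n : ℕ} (h : IsLagrangian B F 𝔥 n) {Φ Ψ : E →L[ℝ] E}
    (hΦΨ : ∀ v, Φ (Ψ v) = v) (hΨΦ : ∀ v, Ψ (Φ v) = v)
    (hΦ : ∀ X Y, Φ (B X Y) = B (Φ X) (Φ Y)) :
    IsLagrangian B (F ∘L Ψ) (𝔥.map (Φ : E →ₗ[ℝ] E)) n := by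
  let e : E ≃ₗ[ℝ] E := LinearEquiv.ofLinearMap (Φ : E →ₗ[ℝ] E) (Ψ : E →ₗ[ℝ] E)
    (LinearMap.ext hΦΨ) (LinearMap.ext hΨΦ)
  have he : (e : E →ₗ[ℝ] E) = (Φ : E →ₗ[ℝ] E) := rfl
  have hrad : radical B (F ∘L Ψ) = (radical B F).map (Φ : E →ₗ[ℝ] E) := by
    ext Z
    simp only [Submodule.mem_map, mem_radical, ContinuousLinearMap.comp_apply,
      ContinuousLinearMap.coe_coe]
    constructor
    · intro hZ
      refine ⟨Ψ Z, fun Y => ?_, hΦΨ Z⟩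
      have := hZ (Φ Y)
      rwa [← hΦΨ Z, ← hΦ, hΨΦ] at this
    · rintro ⟨Z, hZ, rfl⟩ Y
      rw [← hΦΨ Y, ← hΦ, hΨΦ, hZ]
  refine ⟨?_, ?_, ?_, ?_, ?_⟩
  · rintro _ ⟨X, hX, rfl⟩ _ ⟨Y, hY, rfl⟩
    exact ⟨B X Y, h.bracket_mem X hX Y hY, hΦ X Y⟩
  · rintro _ ⟨X, hX, rfl⟩ _ ⟨Y, hY, rfl⟩
    simp only [ContinuousLinearMap.comp_apply, ContinuousLinearMap.coe_coe]
    rw [← hΦ, hΨΦ, h.isotropic X hX Y hY]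
  · rw [hrad]
    exact Submodule.map_mono h.radical_le
  · have h1 := (𝔥.map (Φ : E →ₗ[ℝ] E)).finrank_quotient_add_finrank
    have h2 := 𝔥.finrank_quotient_add_finrank
    have h3 := LinearEquiv.finrank_map_eq e 𝔥
    rw [he] at h3
    have h4 := h.finrank_quotient
    omega
  · rw [hrad, ← he, LinearEquiv.finrank_map_eq]
    exact h.finrank_radical

end Transport

variable {E : Type*} [NormedAddCommGroup E] [NormedSpace ℝ E]
  {G : Type*} [TopologicalSpace G] [ChartedSpace E G] [Group G]

/-- An element of `𝔤*` as a continuous functional on the model space. -/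
def dualCLM [FiniteDimensional ℝ E] (x : DualLieAlg E G) : E →L[ℝ] ℝ :=
  let x' : E →ₗ[ℝ] ℝ := x
  LinearMap.toContinuousLinearMap x'

variable [LieGroup 𝓘(ℝ, E) ∞ G]

lemma coAd_mul (g h : G) (x : DualLieAlg E G) : coAd (g * h) x = coAd g (coAd h x) := by
  refine LinearMap.ext fun X => ?_
  have h1 : AdL (E := E) (g * h)⁻¹ X = AdL (E := E) h⁻¹ (AdL (E := E) g⁻¹ X) := by
    rw [mul_inv_rev, AdL_mul]; rfl
  exact congrArg x h1

lemma coAd_one (x : DualLieAlg E G) : coAd (1 : G) x = x := by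
  refine LinearMap.ext fun X => ?_
  have h1 : AdL (E := E) (1 : G)⁻¹ X = X := by rw [inv_one, AdL_one]; rfl
  exact congrArg x h1

/-- Smoothness near the identity spreads by `Ad(g) = Ad(g₀) Ad(g₀⁻¹g)`. -/
lemma contMDiff_AdL :
    ContMDiff 𝓘(ℝ, E) 𝓘(ℝ, E →L[ℝ] E) ∞ (fun g : G => AdL (E := E) g) := by
  intro g₀
  have hm : ContMDiff 𝓘(ℝ, E) 𝓘(ℝ, E) ∞ (fun g : G => g₀⁻¹ * g) := contMDiff_mul_left
  have h1 : ContMDiffAt 𝓘(ℝ, E) 𝓘(ℝ, E) ∞ (fun g : G => idCoord E (g₀⁻¹ * g)) g₀ :=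
    ContMDiffAt.comp g₀ (contMDiffAt_idCoord (by simpa using one_mem_idRange E G)) hm.contMDiffAt
  have h2 : ContMDiffAt 𝓘(ℝ, E) 𝓘(ℝ, E →L[ℝ] E) ∞
      (fun g : G => AdL (E := E) (idChart E G (idCoord E (g₀⁻¹ * g)))) g₀ := by
    refine ContMDiffAt.comp (g := fun a => AdL (E := E) (idChart E G a)) g₀ ?_ h1
    refine ContDiffAt.contMDiffAt (contDiffAt_AdL (contMDiffAt_idChart ?_))
    simpa using zero_mem_idDomain E G
  have h3 : ContMDiffAt 𝓘(ℝ, E) 𝓘(ℝ, E →L[ℝ] E) ∞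
      (fun g : G => AdL (E := E) g₀ ∘L AdL (E := E) (idChart E G (idCoord E (g₀⁻¹ * g)))) g₀ :=
    ContMDiffAt.comp g₀
      ((ContinuousLinearMap.compL ℝ E E E (AdL (E := E) g₀)).contDiff.contMDiff.contMDiffAt) h2
  refine h3.congr_of_eventuallyEq ?_
  filter_upwards [hm.continuous.continuousAt.eventually_mem ((isOpen_idRange E G).mem_nhds
    (by simpa using one_mem_idRange E G))] with g hg
  rw [idChart_idCoord hg, ← AdL_mul, mul_inv_cancel_left]

variable [FiniteDimensional ℝ E]

lemma contMDiff_dualCLM_coAd (x : DualLieAlg E G) :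
    ContMDiff 𝓘(ℝ, E) 𝓘(ℝ, E →L[ℝ] ℝ) ∞ (fun g : G => dualCLM (coAd g x)) := by
  have h1 : ContMDiff 𝓘(ℝ, E) 𝓘(ℝ, E →L[ℝ] E) ∞ (fun g : G => AdL (E := E) g⁻¹) :=
    contMDiff_AdL.comp (contMDiff_inv 𝓘(ℝ, E) ∞)
  exact (ContinuousLinearMap.compL ℝ E E ℝ (dualCLM x)).contDiff.contMDiff.comp h1

/-- The derivative of a function along the fundamental vector fields of the coadjoint action. -/
lemma mfderiv_coAd_one {M : Type*} [NormedAddCommGroup M] [NormedSpace ℝ M]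
    {f : (E →L[ℝ] ℝ) → M} {x : DualLieAlg E G} (hf : DifferentiableAt ℝ f (dualCLM x)) (X : E) :
    (mfderiv 𝓘(ℝ, E) 𝓘(ℝ, M) (fun h : G => f (dualCLM (coAd h x))) 1 : E →L[ℝ] M) X
      = fderiv ℝ f (dualCLM x) (-(dualCLM x ∘L chartBracket E G X)) := by
  have hA := adjointChart E G
  have hf' : DifferentiableAt ℝ f (dualCLM (coAd (1 : G) x)) := by rwa [coAd_one]
  have hmd : MDifferentiableAt 𝓘(ℝ, E) 𝓘(ℝ, M) (fun h : G => f (dualCLM (coAd h x))) 1 :=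
    MDifferentiableAt.comp (1 : G) hf'.mdifferentiableAt
      ((contMDiff_dualCLM_coAd x).mdifferentiable (by simp) 1)
  refine (congrArg (fun D : E →L[ℝ] M => D X) (mfderiv_one_eq_fderiv hmd)).trans ?_
  have h1 : HasFDerivAt (fun a => dualCLM x ∘L AdL (idChart E G a)⁻¹)
      (ContinuousLinearMap.compL ℝ E E ℝ (dualCLM x) ∘L
        fderiv ℝ (fun a => AdL (E := E) (idChart E G a)⁻¹) 0) 0 :=
    ((ContinuousLinearMap.compL ℝ E E ℝ (dualCLM x)).hasFDerivAt).comp (0 : E)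
      (hA.differentiableAt_Ti hA.zero_mem).hasFDerivAt
  have h0 : dualCLM x ∘L AdL (E := E) (idChart E G 0)⁻¹ = dualCLM x := by
    simp [AdL_one]
  have hf0 : DifferentiableAt ℝ f (dualCLM x ∘L AdL (E := E) (idChart E G 0)⁻¹) := by rwa [h0]
  have h2 := (hf0.hasFDerivAt.comp (0 : E) h1).fderiv
  have h3 : ∀ a, f (dualCLM (coAd (idChart E G a) x))
      = (f ∘ fun a => dualCLM x ∘L AdL (idChart E G a)⁻¹) a := fun _ => rfl
  simp_rw [h3]
  rw [h2, h0, ContinuousLinearMap.comp_apply]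
  congr 1
  ext v
  have h4 := hA.fderiv_Ti hA.zero_mem X v
  rw [hA.ε_zero, hA.Ti_zero] at h4
  simp [h4]

lemma fundDeriv_eq {f : (E →L[ℝ] ℝ) → ℝ} {x : DualLieAlg E G}
    (hf : DifferentiableAt ℝ f (dualCLM x)) (X : LieAlg E G) :
    fundDeriv (fun y => f (dualCLM y)) x X
      = fderiv ℝ f (dualCLM x) (-(dualCLM x ∘L chartBracket E G X)) :=
  mfderiv_coAd_one hf X

lemma dualCLM_chartBracket (x : DualLieAlg E G) (X Y : LieAlg E G) :
    dualCLM x (chartBracket E G X Y) = x ⁅X, Y⁆ :=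
  congrArg x (lie_eq_chartBracket X Y).symm

lemma lie_mem_realSubalg (𝔭 : LieSubalgebra ℂ (ComplexLieAlg E G)) {X Y : LieAlg E G}
    (hX : X ∈ realSubalg 𝔭) (hY : Y ∈ realSubalg 𝔭) : ⁅X, Y⁆ ∈ realSubalg 𝔭 := by
  have h : (1 : ℂ) ⊗ₜ[ℝ] ⁅X, Y⁆ = ⁅(1 : ℂ) ⊗ₜ[ℝ] X, (1 : ℂ) ⊗ₜ[ℝ] Y⁆ := by
    rw [LieAlgebra.ExtendScalars.bracket_tmul, one_mul]
  have h2 : (1 : ℂ) ⊗ₜ[ℝ] ⁅X, Y⁆ ∈ 𝔭 := by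
    rw [h]
    exact 𝔭.lie_mem hX hY
  exact h2

lemma IsPolarization.isLagrangian {F : DualLieAlg E G}
    {𝔭 : LieSubalgebra ℂ (ComplexLieAlg E G)} (h : IsPolarization F 𝔭) :
    IsLagrangian (chartBracket E G) (dualCLM F) (realSubalg 𝔭)
      (Module.finrank ℝ (LieAlg E G ⧸ realSubalg 𝔭)) := by
  have hrad : radical (chartBracket E G) (dualCLM F) = stabAlg F := by
    ext Z
    rw [mem_radical]
    exact forall_congr' fun Y => Iff.of_eq (congrArg (· = 0) (dualCLM_chartBracket F Z Y))
  have key : ∀ X Y : LieAlg E G, X ∈ realSubalg 𝔭 → Y ∈ realSubalg 𝔭 →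
      (chartBracket E G X Y : LieAlg E G) ∈ realSubalg 𝔭 := fun X Y hX hY =>
    (lie_eq_chartBracket X Y) ▸ lie_mem_realSubalg 𝔭 hX hY
  refine ⟨fun X hX Y hY => ?_, fun X hX Y hY => ?_, ?_, rfl, ?_⟩
  · exact key X Y hX hY
  · exact (dualCLM_chartBracket F X Y).trans (h.isotropic X hX Y hY)
  · rw [hrad]
    exact h.stab_le
  · have h1 := h.codim
    have h2 := (radical (chartBracket E G) (dualCLM F)).finrank_le
    rw [hrad] at h2 ⊢
    rw [h1]
    -- The truncated subtraction in `orbitDim` is a true one, since the radical is a subspace of the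
    -- Lie algebra.
    exact Nat.sub_add_cancel h2

end

/-! ### Coordinates on the coadjoint orbit. -/

section

variable {E : Type*} [NormedAddCommGroup E] [NormedSpace ℝ E]
  {G : Type*} [TopologicalSpace G] [ChartedSpace E G] [Group G]
  [LieGroup 𝓘(ℝ, E) ∞ G]

lemma isOpen_image_idChart {U : Set E} (hU : IsOpen U) (hUΩ : U ⊆ idDomain E G) :
    IsOpen (idChart E G '' U) := by
  have h : idChart E G '' U = idRange E G ∩ (idCoord E : G → E) ⁻¹' U := by
    ext g
    constructor
    · rintro ⟨a, ha, rfl⟩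
      exact ⟨idChart_mem (hUΩ ha), by rwa [Set.mem_preimage, idCoord_idChart (hUΩ ha)]⟩
    · rintro ⟨hg, hgU⟩
      exact ⟨idCoord E g, hgU, idChart_idCoord hg⟩
  rw [h]
  have hc : ContinuousOn (idCoord E : G → E) (idRange E G) := fun g hg =>
    (contMDiffAt_idCoord hg).continuousAt.continuousWithinAt
  exact hc.isOpen_inter_preimage (isOpen_idRange E G) hU

/-- The saturation of an open set of the group is open. -/
lemma isOpen_setOf_coAd_mem {F : DualLieAlg E G} {g₀ : G} {O : Set G} (hO : IsOpen O) :
    IsOpen {g : G | coAd g F ∈ (fun u => coAd u (coAd g₀ F)) '' O} := by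
  -- `K(g)F = K(u g₀)F` exactly when `s = g⁻¹ u g₀` fixes `F`, and then `u = g s g₀⁻¹`.
  have h : {g : G | coAd g F ∈ (fun u => coAd u (coAd g₀ F)) '' O}
      = ⋃ s ∈ stabilizer F, (fun g : G => g * (s * g₀⁻¹)) ⁻¹' O := by
    ext g
    simp only [Set.mem_ofPred_eq, Set.mem_iUnion, Set.mem_preimage, Set.mem_image]
    constructor
    · rintro ⟨u, hu, h⟩
      refine ⟨g⁻¹ * (u * g₀), ?_, by simpa [mul_assoc] using hu⟩
      change coAd (g⁻¹ * (u * g₀)) F = F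
      rw [coAd_mul, coAd_mul, h, ← coAd_mul, inv_mul_cancel, coAd_one]
    · rintro ⟨s, hs, h⟩
      refine ⟨_, h, ?_⟩
      rw [← coAd_mul]
      have hs' : coAd s F = F := hs
      rw [mul_assoc, mul_assoc, inv_mul_cancel, mul_one, coAd_mul, hs']
  rw [h]
  refine isOpen_biUnion fun s _ => hO.preimage ?_
  exact (contMDiff_mul_right (I := 𝓘(ℝ, E)) (n := ∞)).continuous

variable [FiniteDimensional ℝ E]

/-- The pullback to the group of a function with surjective derivative along the fundamental
vector fields is a submersion. -/
lemma surjective_mfderiv_coAd {M : Type*} [NormedAddCommGroup M] [NormedSpace ℝ M]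
    {f : (E →L[ℝ] ℝ) → M} {F : DualLieAlg E G} {g : G}
    (hf : DifferentiableAt ℝ f (dualCLM (coAd g F)))
    (hs : ∀ w, ∃ X, fderiv ℝ f (dualCLM (coAd g F))
      (-(dualCLM (coAd g F) ∘L chartBracket E G X)) = w) :
    Function.Surjective
      (mfderiv 𝓘(ℝ, E) 𝓘(ℝ, M) (fun g : G => f (dualCLM (coAd g F))) g) := by
  intro w
  obtain ⟨X, hX⟩ := hs w
  have hR : MDifferentiableAt 𝓘(ℝ, E) 𝓘(ℝ, E) (fun h : G => h * g) 1 :=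
    (contMDiff_mul_right (I := 𝓘(ℝ, E)) (n := ∞)).mdifferentiable (by simp) 1
  have hψ : MDifferentiableAt 𝓘(ℝ, E) 𝓘(ℝ, M) (fun g : G => f (dualCLM (coAd g F))) g :=
    MDifferentiableAt.comp g hf.mdifferentiableAt
      ((contMDiff_dualCLM_coAd F).mdifferentiable (by simp) g)
  -- Right translation by `g` reduces the derivative at `g` to the derivative at the identity for
  -- the base point `K(g)F`.
  have h1 := mfderiv_comp_of_eq (x := (1 : G)) hψ hR (one_mul g)
  have h2 : (fun g : G => f (dualCLM (coAd g F))) ∘ (fun h : G => h * g)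
      = fun h : G => f (dualCLM (coAd h (coAd g F))) := by
    funext h
    simp only [Function.comp_apply, coAd_mul]
  rw [h2] at h1
  have h3 := mfderiv_coAd_one hf X
  have key : ∀ g' : G, g' = g → ∀ v : E,
      (mfderiv 𝓘(ℝ, E) 𝓘(ℝ, M) (fun g : G => f (dualCLM (coAd g F))) g' : E →L[ℝ] M) v
        = (mfderiv 𝓘(ℝ, E) 𝓘(ℝ, M) (fun g : G => f (dualCLM (coAd g F))) g : E →L[ℝ] M) v := by
    rintro g' rfl v
    rfl
  have h4 := congrArg (fun D : E →L[ℝ] M => D X) h1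
  exact ⟨_, (key _ (one_mul g) _).symm.trans (h4.symm.trans (h3.trans hX))⟩

/-- Local coordinates on an orbit from functions on an open subset of the dual space. -/
lemma isLocalCoordinates_of_contDiffOn {B : Type*} [NormedAddCommGroup B] [NormedSpace ℝ B]
    {F : DualLieAlg E G} {g₀ : G} {O : Set G} (hO : IsOpen O) {W : Set (E →L[ℝ] ℝ)}
    (hW : IsOpen W) {f : (E →L[ℝ] ℝ) → B} (hf : ContDiffOn ℝ ∞ f W)
    (hOW : ∀ u ∈ O, dualCLM (coAd u (coAd g₀ F)) ∈ W)
    (hinj : Set.InjOn (fun x => f (dualCLM x)) ((fun u => coAd u (coAd g₀ F)) '' O))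
    (hs : ∀ u ∈ O, ∀ w, ∃ X, fderiv ℝ f (dualCLM (coAd u (coAd g₀ F)))
      (-(dualCLM (coAd u (coAd g₀ F)) ∘L chartBracket E G X)) = w) :
    IsLocalCoordinates F ((fun u => coAd u (coAd g₀ F)) '' O) (fun x => f (dualCLM x)) where
  subset_orbit := by
    rintro _ ⟨u, _, rfl⟩
    exact ⟨u * g₀, coAd_mul u g₀ F⟩
  isOpen_preimage := isOpen_setOf_coAd_mem hO
  injOn := hinj
  smooth := by
    rintro g ⟨u, hu, h⟩
    have h1 : dualCLM (coAd g F) ∈ W := by rw [← h]; exact hOW u hu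
    have h2 : ContMDiffAt 𝓘(ℝ, E →L[ℝ] ℝ) 𝓘(ℝ, B) ∞ f (dualCLM (coAd g F)) :=
      (hf.contDiffAt (hW.mem_nhds h1)).contMDiffAt
    exact (ContMDiffAt.comp g h2 (contMDiff_dualCLM_coAd F).contMDiffAt).contMDiffWithinAt
  submersion := by
    rintro g ⟨u, hu, h⟩
    have h1 : dualCLM (coAd g F) ∈ W := by rw [← h]; exact hOW u hu
    refine surjective_mfderiv_coAd
      ((hf.contDiffAt (hW.mem_nhds h1)).differentiableAt (by simp)) ?_
    rw [← h]
    exact hs u hu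

/-- Darboux coordinates near any point of the orbit in which the Hamiltonians are affine in the
momenta. -/
theorem exists_isDarbouxCoordinates_affine {F : DualLieAlg E G} {𝔥 : Submodule ℝ E} {n : ℕ}
    (h𝔥 : IsLagrangian (chartBracket E G) (dualCLM F) 𝔥 n) (g₀ : G) :
    ∃ (V : Set (DualLieAlg E G)) (q p : DualLieAlg E G → Fin n → ℝ),
      coAd g₀ F ∈ V ∧ IsDarbouxCoordinates n F V q p ∧
      ∀ X : LieAlg E G, ∃ (a : Fin n → (Fin n → ℝ) → ℝ) (a₀ : (Fin n → ℝ) → ℝ),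
        (∀ i, ContDiffOn ℝ ∞ (a i) (q '' V)) ∧ ContDiffOn ℝ ∞ a₀ (q '' V) ∧
        ∀ y ∈ V, hamiltonian X y = ∑ i, a i (q y) * p y i + a₀ (q y) := by
  set x₀ := coAd g₀ F with hx₀
  have hL : IsLagrangian (chartBracket E G) (dualCLM x₀) (𝔥.map (AdL (E := E) g₀ : E →ₗ[ℝ] E)) n :=
    h𝔥.map (AdL_apply_inv g₀) (AdL_inv_apply g₀) (chartBracket_AdL g₀)
  obtain ⟨W, U, q, p, hW, hU, hU0, hUΩ, hUW, hqp, hsurj, hdar, haff⟩ :=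
    exists_darboux_affine (adjointChart E G) hL.bracket_mem hL.isotropic hL.radical_le
      hL.finrank_quotient hL.finrank_radical
  have hUd : U ⊆ idDomain E G := fun a ha => (hUΩ ha).1
  have hWm : ∀ u ∈ idChart E G '' U, dualCLM (coAd u x₀) ∈ W := by
    rintro _ ⟨a, ha, rfl⟩
    exact hUW a ha
  set V : Set (DualLieAlg E G) := (fun u => coAd u x₀) '' (idChart E G '' U) with hV
  have hqVW : (fun x => q (dualCLM x)) '' V ⊆ q '' W := by
    rintro _ ⟨_, ⟨u, hu, rfl⟩, rfl⟩
    exact ⟨_, hWm u hu, rfl⟩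
  have haff' : ∀ X : LieAlg E G, ∃ (a : Fin n → (Fin n → ℝ) → ℝ) (a₀ : (Fin n → ℝ) → ℝ),
      (∀ i, ContDiffOn ℝ ∞ (a i) ((fun x => q (dualCLM x)) '' V)) ∧
      ContDiffOn ℝ ∞ a₀ ((fun x => q (dualCLM x)) '' V) ∧
      ∀ y ∈ V, hamiltonian X y
        = ∑ i, a i (q (dualCLM y)) * p (dualCLM y) i + a₀ (q (dualCLM y)) := by
    intro X
    obtain ⟨a, a₀, ha, ha₀, h⟩ := haff X
    refine ⟨a, a₀, fun i => (ha i).mono hqVW, ha₀.mono hqVW, ?_⟩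
    rintro _ ⟨_, ⟨b, hb, rfl⟩, rfl⟩
    exact h b hb
  refine ⟨V, fun x => q (dualCLM x), fun x => p (dualCLM x), ?_, ⟨?_, ?_⟩, haff'⟩
  · exact ⟨1, ⟨0, hU0, idChart_zero E G⟩, coAd_one x₀⟩
  · refine isLocalCoordinates_of_contDiffOn (isOpen_image_idChart hU hUd) hW hqp hWm ?_ ?_
    -- Equal coordinates give equal values of every linear function, by the affine formula, hence
    -- equal points.
    · intro x hx y hy hxy
      obtain ⟨h1, h2⟩ := Prod.mk.inj hxy
      refine LinearMap.ext fun X => ?_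
      obtain ⟨a, a₀, -, -, h⟩ := haff' X
      have h3 := h x hx
      rw [h1, h2, ← h y hy] at h3
      exact h3
    · rintro _ ⟨a, ha, rfl⟩ w
      exact hsurj a ha w
  · rintro x hx X Y
    have hxW : dualCLM x ∈ W := by
      obtain ⟨u, hu, rfl⟩ := hx
      exact hWm u hu
    have hd := (hqp.contDiffAt (hW.mem_nhds hxW)).differentiableAt (by simp)
    have hqd : DifferentiableAt ℝ q (dualCLM x) := hd.fst
    have hpd : DifferentiableAt ℝ p (dualCLM x) := hd.snd
    have hfund : ∀ {r : (E →L[ℝ] ℝ) → Fin n → ℝ}, DifferentiableAt ℝ r (dualCLM x) →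
        ∀ (i : Fin n) (Z : LieAlg E G), fundDeriv (fun y => r (dualCLM y) i) x Z
          = fderiv ℝ r (dualCLM x) (-(dualCLM x ∘L chartBracket E G Z)) i := by
      intro r hr i Z
      have h1 := hasFDerivAt_pi'.1 hr.hasFDerivAt i
      refine (fundDeriv_eq h1.differentiableAt Z).trans ?_
      rw [h1.fderiv]
      rfl
    simp_rw [hfund hqd, hfund hpd]
    refine (dualCLM_chartBracket x X Y).symm.trans ?_
    obtain ⟨_, ⟨a, ha, rfl⟩, rfl⟩ := hx
    exact hdar a ha X Y

end

end CoadjointOrbit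

end

theorem theorem1p4 {E : Type*} [NormedAddCommGroup E] [NormedSpace ℝ E] [FiniteDimensional ℝ E]
    {G : Type*} [TopologicalSpace G] [ChartedSpace E G] [Group G] [LieGroup 𝓘(ℝ, E) ∞ G]
    [SimplyConnectedSpace G]
    (F : CoadjointOrbit.DualLieAlg E G)
    (𝔭 : LieSubalgebra ℂ (CoadjointOrbit.ComplexLieAlg E G))
    (hpol : CoadjointOrbit.IsPolarization F 𝔭)
    (hpuk : CoadjointOrbit.PukanszkyCondition F 𝔭) :
    ∃ n : ℕ, 2 * n = CoadjointOrbit.orbitDim F ∧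
      ∀ x ∈ CoadjointOrbit.orbit F,
        ∃ (V : Set (CoadjointOrbit.DualLieAlg E G))
          (q p : CoadjointOrbit.DualLieAlg E G → Fin n → ℝ),
          x ∈ V ∧ CoadjointOrbit.IsDarbouxCoordinates n F V q p ∧
          ∀ X : CoadjointOrbit.LieAlg E G,
            ∃ (a : Fin n → (Fin n → ℝ) → ℝ) (a₀ : (Fin n → ℝ) → ℝ),
              (∀ i, ContDiffOn ℝ ∞ (a i) (q '' V)) ∧ ContDiffOn ℝ ∞ a₀ (q '' V) ∧
              ∀ y ∈ V, CoadjointOrbit.hamiltonian X y = ∑ i, a i (q y) * p y i + a₀ (q y) := by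
  -- Here `n` is the codimension of `𝔥`.
  refine ⟨_, hpol.codim, ?_⟩
  rintro _ ⟨g₀, rfl⟩
  exact CoadjointOrbit.exists_isDarbouxCoordinates_affine hpol.isLagrangian g₀
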